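/- Let $e_1,\dots,e_8$ be the standard orthonormal basis of Euclidean $\mathbb R^8$ and let $\mathrm{Cl}(8)$ be its Clifford algebra, with $v^2=|v|^2$ for vectors $v$. Write $\tilde A$ for the reverse of $A$, $e_{k_1\cdots k_r}=e_{k_1}\cdots e_{k_r}$, $v\wedge w=\frac12(vw-wv)$, and $\exp$ for the exponential series in $\mathrm{Cl}(8)$. Put $$\alpha_1=\tfrac{1}{\sqrt2}(e_7-e_6),\ \alpha_2=\tfrac{1}{\sqrt2}(e_6-e_5),\ \alpha_3=\tfrac{1}{\sqrt2}(e_5-e_4),\ \alpha_4=\tfrac{1}{\sqrt2}(e_4-e_3),$$ $$\alpha_5=\tfrac{1}{\sqrt2}(e_3-e_2),\ \alpha_6=\tfrac{1}{\sqrt2}(e_2-e_1),\ \alpha_8=\tfrac{1}{\sqrt2}(e_2+e_1),\ \alpha_7=\tfrac{1}{\sqrt8}(e_1-e_2-e_3-e_4-e_5-e_6-e_7+e_8),$$ $$W=\alpha_2\alpha_4\alpha_6\alpha_8\alpha_3\alpha_5\alpha_1\alpha_7 ,$$ and let $w=s_7s_1s_5s_3s_8s_6s_4s_2$ (composition, $s_2$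 applied first) be the Coxeter element, $s_i$ being the reflection in the hyperplane $\alpha_i^\perp$. Then the following hold. 1. The matrix $2(\alpha_i|\alpha_j)/(\alpha_j|\alpha_j)$ is the Cartan matrix of $E_8$, for the Dynkin diagram with chain $\alpha_1-\alpha_2-\cdots-\alpha_7$ and $\alpha_8$ attached to $\alpha_5$. 2. The expansion of $W$ in basis blades is given by $$\begin{aligned}16\,W={}& 6\,e_{134567}\\& +4(e_{124567}+e_{123567}+e_{1357})\\& -4(e_{1467}+e_{1346}+e_{1345})\\& +2(e_{1347}+e_{1267}+e_{17}+e_{123467}+e_{1257}+e_{123457}+e_{14}+e_{13})\\& -2(e_{1567}+e_{1456}+e_{1356}+e_{1246}+e_{1236}+e_{1245}+e_{1235})\\& +(e_{234567}+e_{12345678}+e_{1678}+e_{125678}+e_{67}+e_{2567}+e_{135678}+e_{3567}+e_{1348}+e_{34}+e_{123478}+e_{2347}+e_{123578}+e_{2357}+e_{1568}+e_{1278}+e_{56}+e_{1378}+e_{37}+e_{2457}+e_{134578}+e_{3457}+e_{27}+e_{1248}+e_{24}+e_{1238}+e_{23}+e_{1468}+e_{124578}+e_{1458}+e_{46}+e_{45})\\&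 -(1+e_{145678}+e_{123678}+e_{4567}+e_{2367}+e_{124678}+e_{2467}+e_{134678}+e_{3467}+e_{1478}+e_{47}+e_{1578}+e_{57}+e_{134568}+e_{3456}+e_{124568}+e_{1268}+e_{2456}+e_{123568}+e_{18}+e_{26}+e_{2356}+e_{123468}+e_{2346}+e_{1258}+e_{25}+e_{123458}+e_{2345}+e_{1368}+e_{1358}+e_{36}+e_{35}) \end{aligned}$$ 3. $w(x)=\tilde W x W$ for all vectors $x$, and $w$ has order $30$ (the Coxeter number). 4. There are vectors $v_1,w_1,\dots,v_4,w_4$ such that every coordinate agrees with the following numerical values up to a relative error of at most $10^{-4}$ (coordinates that are not listed being exactly $0$), - $v_1\approx 2.8129(e_3+e_4)+4.5514(e_5+e_6)+5.1395e_7+21.771e_8$, - $w_1\approx -0.23919e_1+1.6534(e_2+e_3)+3.9417(e_4+e_5)+5.1113(e_6+e_7)+21.652e_8$, - $v_2\approx 1.1504(e_3+e_4)+1.8614(e_5+e_6)-0.2405e_7-1.0188e_8$, - $w_2\approx 2.0904e_1-0.6762(e_2+e_3)+1.612(e_4+e_5)-0.097822(e_6+e_7)-0.4144e_8$, - $v_3\approx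 2.1019(e_3+e_4)-1.2991(e_5+e_6)-4.112e_7+0.97071e_8$, - $w_3\approx -0.58484e_1+1.9991(e_2+e_3)+1.125(e_4+e_5)-3.0558(e_6+e_7)+0.72138e_8$, - $v_4\approx 0.58806(e_3+e_4)-0.36344(e_5+e_6)+0.78698e_7-0.18578e_8$, - $w_4\approx 0.85493e_1+0.55928(e_2+e_3)-0.31475(e_4+e_5)+0.16362(e_6+e_7)-0.038626e_8$, with the following properties. The spans $P_i$ of $v_i,w_i$ are four mutually orthogonal planes; the unit bivectors $B_i=(v_i\wedge w_i)/\sqrt{|v_i|^2|w_i|^2-(v_i|w_i)^2}$ satisfy $B_i^2=-1$; and, writing $B_C=B_1$, $$W=-\exp\!\big(\tfrac{\pi}{30}B_C\big)\exp\!\big(\tfrac{11\pi}{30}B_2\big)\exp\!\big(\tfrac{7\pi}{30}B_3\big)\exp\!\big(\tfrac{13\pi}{30}B_4\big).$$ With $(m_1,m_2,m_3,m_4)=(1,11,7,13)$, each plane $P_i$ is preserved by $w$, which acts on it as the 30-fold rotation $w(x)=\exp\!\big(-\tfrac{2\pi m_i}{30}B_i\big)x$; every nonzero $x\in P_i$ has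 period exactly $30$ under $w$. 5. The complex eigenvalues of $w$, counted with multiplicity, are $e^{2\pi i k/30}$ for $k\in\{1,7,11,13,17,19,23,29\}$, the exponents of $E_8$. -/

import Mathlib

namespace E8Coxeter

/-- Eight-dimensional Euclidean space. -/
abbrev E := EuclideanSpace ℝ (Fin 8)

/-- The Euclidean quadratic form `v ↦ ⟪v, v⟫`. -/
noncomputable abbrev euclideanForm : QuadraticForm ℝ E :=
  LinearMap.BilinMap.toQuadraticMap (innerₗ E)

/-- The Clifford algebra `Cl(8)` of eight-dimensional Euclidean space (`v * v = ⟪v, v⟫`). -/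
abbrev Cl8 := CliffordAlgebra euclideanForm

theorem euclideanForm_apply (v : E) : euclideanForm v = inner ℝ v v := rfl

instance instModuleFiniteCl8 : Module.Finite ℝ Cl8 := by
  let _ : Invertible (2 : ℝ) := invertibleOfNonzero two_ne_zero
  have _ : Module.Finite ℝ (ExteriorAlgebra ℝ E) :=
    Module.Finite.of_basis
      (Module.Basis.ExteriorAlgebra (EuclideanSpace.basisFun (Fin 8) ℝ).toBasis)
  exact Module.Finite.equiv (CliffordAlgebra.equivExterior euclideanForm).symm

/-- `Cl(8)` carries its canonical topology as a finite-dimensional real vector space; the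
exponential `NormedSpace.exp` below is the sum of the exponential series in it. -/
noncomputable instance instTopologicalSpaceCl8 : TopologicalSpace Cl8 := moduleTopology ℝ Cl8

instance instIsModuleTopologyCl8 : IsModuleTopology ℝ Cl8 := ⟨rfl⟩

instance instIsTopologicalRingCl8 : IsTopologicalRing Cl8 :=
  IsModuleTopology.isTopologicalRing ℝ Cl8

/-- A vector regarded as an element of the Clifford algebra. -/
noncomputable def vec (v : E) : Cl8 := CliffordAlgebra.ι euclideanForm v

/-- The outer product `v ∧ w = (v w - w v) / 2` of two vectors. -/
noncomputable def wedge (v w : E) : Cl8 := (1 / 2 : ℝ) • (vec v * vec w - vec w * vec v)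

/-- The area `√(|v|² |w|² - ⟪v, w⟫²)` of the parallelogram spanned by two vectors. -/
noncomputable def area (v w : E) : ℝ := √(‖v‖ ^ 2 * ‖w‖ ^ 2 - inner ℝ v w ^ 2)

/-- The unit bivector of the oriented plane spanned by `v` and `w`. -/
noncomputable def unitBivector (v w : E) : Cl8 := (area v w)⁻¹ • wedge v w

/-- The plane spanned by two vectors. -/
def plane (v w : E) : Submodule ℝ E := Submodule.span ℝ {v, w}

/-- The simple roots: `α i` is the root `α_{i+1}` in the usual numbering `α_1, …, α_8`. -/
noncomputable def α : Fin 8 → E :=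
  ![(1 / √2 : ℝ) • !₂[0, 0, 0, 0, 0, -1, 1, 0],
    (1 / √2 : ℝ) • !₂[0, 0, 0, 0, -1, 1, 0, 0],
    (1 / √2 : ℝ) • !₂[0, 0, 0, -1, 1, 0, 0, 0],
    (1 / √2 : ℝ) • !₂[0, 0, -1, 1, 0, 0, 0, 0],
    (1 / √2 : ℝ) • !₂[0, -1, 1, 0, 0, 0, 0, 0],
    (1 / √2 : ℝ) • !₂[-1, 1, 0, 0, 0, 0, 0, 0],
    (1 / √8 : ℝ) • !₂[1, -1, -1, -1, -1, -1, -1, 1],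
    (1 / √2 : ℝ) • !₂[1, 1, 0, 0, 0, 0, 0, 0]]

/-- The relabelling of the nodes of the Dynkin diagram (`α_1 - α_2 - ⋯ - α_7`, with `α_8` attached
to `α_5`) to the Bourbaki labelling used in `CartanMatrix.E₈`. -/
def toBourbaki : Fin 8 → Fin 8 := ![7, 6, 5, 4, 3, 2, 0, 1]

/-- The Coxeter versor `W = α_2 α_4 α_6 α_8 α_3 α_5 α_1 α_7`. -/
noncomputable def coxeterVersor : Cl8 :=
  vec (α 1) * vec (α 3) * vec (α 5) * vec (α 7) * vec (α 2) * vec (α 4) * vec (α 0) * vec (α 6)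

/-- The standard basis vector `e_k` (`1 ≤ k ≤ 8`) as an element of the Clifford algebra. -/
noncomputable def e (k : ℕ) : Cl8 := vec (EuclideanSpace.single (Fin.ofNat 8 (k - 1)) 1)

/-- The basis blade `e_{k₁,…,k_r} = e_{k₁} ⋯ e_{k_r}`. -/
noncomputable def blade (l : List ℕ) : Cl8 := (l.map e).prod

/-- The terms of the expansion of `16 W` in basis blades: coefficient and index set. -/
def versorTerms : List (ℤ × List ℕ) :=
  [(-1, []), (1, [2, 3, 4, 5, 6, 7]), (1, [1, 2, 3, 4, 5, 6, 7, 8]), (-1, [1, 4, 5, 6, 7, 8]),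
   (-1, [1, 2, 3, 6, 7, 8]), (-1, [4, 5, 6, 7]), (-1, [2, 3, 6, 7]), (1, [1, 6, 7, 8]),
   (1, [1, 2, 5, 6, 7, 8]), (1, [6, 7]), (1, [2, 5, 6, 7]), (1, [1, 3, 5, 6, 7, 8]),
   (-1, [1, 2, 4, 6, 7, 8]), (1, [3, 5, 6, 7]), (-1, [2, 4, 6, 7]), (-1, [1, 3, 4, 6, 7, 8]),
   (-1, [3, 4, 6, 7]), (1, [1, 3, 4, 8]), (1, [3, 4]), (1, [1, 2, 3, 4, 7, 8]),
   (-1, [1, 4, 7, 8]), (1, [2, 3, 4, 7]), (1, [1, 2, 3, 5, 7, 8]), (-1, [4, 7]),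
   (1, [2, 3, 5, 7]), (-1, [1, 5, 7, 8]), (-1, [5, 7]), (-2, [1, 5, 6, 7]), (1, [1, 5, 6, 8]),
   (1, [1, 2, 7, 8]), (1, [5, 6]), (1, [1, 3, 7, 8]), (1, [3, 7]), (1, [2, 4, 5, 7]),
   (1, [1, 3, 4, 5, 7, 8]), (2, [1, 3, 4, 7]), (-1, [1, 3, 4, 5, 6, 8]), (1, [3, 4, 5, 7]),
   (6, [1, 3, 4, 5, 6, 7]), (-1, [3, 4, 5, 6]), (4, [1, 2, 4, 5, 6, 7]),
   (-1, [1, 2, 4, 5, 6, 8]), (-1, [1, 2, 6, 8]), (-1, [2, 4, 5, 6]), (2, [1, 2, 6, 7]),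
   (-1, [1, 2, 3, 5, 6, 8]), (1, [2, 7]), (2, [1, 7]), (-1, [1, 8]), (-1, [2, 6]),
   (4, [1, 2, 3, 5, 6, 7]), (-1, [2, 3, 5, 6]), (2, [1, 2, 3, 4, 6, 7]),
   (-1, [1, 2, 3, 4, 6, 8]), (-1, [2, 3, 4, 6]), (1, [1, 2, 4, 8]), (1, [2, 4]),
   (-1, [1, 2, 5, 8]), (2, [1, 2, 5, 7]), (-1, [2, 5]), (1, [1, 2, 3, 8]), (1, [2, 3]),
   (-1, [1, 2, 3, 4, 5, 8]), (2, [1, 2, 3, 4, 5, 7]), (1, [1, 4, 6, 8]), (-1, [2, 3, 4, 5]),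
   (1, [1, 2, 4, 5, 7, 8]), (-4, [1, 4, 6, 7]), (-1, [1, 3, 6, 8]), (1, [1, 4, 5, 8]),
   (4, [1, 3, 5, 7]), (-1, [1, 3, 5, 8]), (-2, [1, 4, 5, 6]), (-2, [1, 3, 5, 6]),
   (-4, [1, 3, 4, 6]), (2, [1, 4]), (2, [1, 3]), (-4, [1, 3, 4, 5]), (-2, [1, 2, 4, 6]),
   (-2, [1, 2, 3, 6]), (-2, [1, 2, 4, 5]), (-2, [1, 2, 3, 5]), (1, [4, 6]), (1, [4, 5]),
   (-1, [3, 6]), (-1, [3, 5])]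

/-- The simple reflection `s_i`, in the hyperplane orthogonal to `α i`. -/
noncomputable def simpleReflection (i : Fin 8) : E ≃ₗᵢ[ℝ] E :=
  (Submodule.span ℝ {α i})ᗮ.reflection

/-- The Coxeter element: the reflections are applied in the order `s_2, s_4, s_6, s_8, s_3, s_5,
s_1, s_7` (the order in which they occur in `λ ↦ W̃ λ W`), the product being composition. -/
noncomputable def coxeterElement : E ≃ₗᵢ[ℝ] E :=
  simpleReflection 6 * simpleReflection 0 * simpleReflection 4 * simpleReflection 2 *
    simpleReflection 7 * simpleReflection 5 * simpleReflection 3 * simpleReflection 1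

/-- The integers `m_i` in the rotation angles of the four factors. -/
def m : Fin 4 → ℕ := ![1, 11, 7, 13]

/-- Numerical values of the first vectors `v_1, …, v_4` of the spanning pairs of the planes. -/
noncomputable def vNum : Fin 4 → Fin 8 → ℝ :=
  ![![0, 0, 2.8129, 2.8129, 4.5514, 4.5514, 5.1395, 21.771],
    ![0, 0, 1.1504, 1.1504, 1.8614, 1.8614, -0.2405, -1.0188],
    ![0, 0, 2.1019, 2.1019, -1.2991, -1.2991, -4.112, 0.97071],
    ![0, 0, 0.58806, 0.58806, -0.36344, -0.36344, 0.78698, -0.18578]]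

/-- Numerical values of the second vectors `w_1, …, w_4` of the spanning pairs of the planes. -/
noncomputable def wNum : Fin 4 → Fin 8 → ℝ :=
  ![![-0.23919, 1.6534, 1.6534, 3.9417, 3.9417, 5.1113, 5.1113, 21.652],
    ![2.0904, -0.6762, -0.6762, 1.612, 1.612, -0.097822, -0.097822, -0.4144],
    ![-0.58484, 1.9991, 1.9991, 1.125, 1.125, -3.0558, -3.0558, 0.72138],
    ![0.85493, 0.55928, 0.55928, -0.31475, -0.31475, 0.16362, 0.16362, -0.038626]]

end E8Coxeter

namespace E8Coxeter

theorem vec_add (v w : E) : vec (v + w) = vec v + vec w := map_add _ _ _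
theorem vec_sub (v w : E) : vec (v - w) = vec v - vec w := map_sub _ _ _
theorem vec_neg (v : E) : vec (-v) = -vec v := map_neg _ _
theorem vec_smul (c : ℝ) (v : E) : vec (c • v) = c • vec v := map_smul _ _ _

theorem vec_mul_self (v : E) : vec v * vec v = (inner ℝ v v : ℝ) • (1 : Cl8) := by
  rw [vec, CliffordAlgebra.ι_sq_scalar, euclideanForm_apply, Algebra.algebraMap_eq_smul_one]

theorem vec_mul_swap (v w : E) :
    vec w * vec v = (2 * inner ℝ v w : ℝ) • (1 : Cl8) - vec v * vec w := by
  have h := vec_mul_self (v + w)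
  rw [vec_add, add_mul, mul_add, mul_add, vec_mul_self, vec_mul_self, inner_add_left,
    inner_add_right, inner_add_right, real_inner_comm v w] at h
  rw [eq_sub_iff_add_eq]
  have h2 : vec w * vec v + vec v * vec w =
    (inner ℝ v v • (1 : Cl8) + vec v * vec w + (vec w * vec v + inner ℝ w w • (1 : Cl8))) -
      inner ℝ v v • (1 : Cl8) - inner ℝ w w • (1 : Cl8) := by abel
  rw [h2, h]
  module

theorem vec_mul_of_inner_eq_zero {v w : E} (h : inner ℝ v w = 0) :
    vec w * vec v = -(vec v * vec w) := by
  rw [vec_mul_swap, h]; simp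

instance instNontrivialCl8 : Nontrivial Cl8 := by
  let _ : Invertible (2 : ℝ) := invertibleOfNonzero two_ne_zero
  exact (CliffordAlgebra.equivExterior euclideanForm).toEquiv.nontrivial

theorem vec_injective : Function.Injective vec := by
  intro v w h
  have h0 := vec_mul_self (v - w)
  rw [vec_sub, h, sub_self, zero_mul] at h0
  exact sub_eq_zero.mp (inner_self_eq_zero.mp
    ((smul_eq_zero.mp h0.symm).resolve_right one_ne_zero))

theorem vec_ne_zero {v : E} (h : v ≠ 0) : vec v ≠ 0 := fun h' =>
  h (vec_injective (h'.trans (map_zero _).symm))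

theorem wedge_eq (v w : E) : wedge v w = vec v * vec w - (inner ℝ v w : ℝ) • (1 : Cl8) := by
  rw [wedge, vec_mul_swap v w]; module

theorem wedge_smul_smul (s t : ℝ) (v w : E) : wedge (s • v) (t • w) = (s * t) • wedge v w := by
  simp only [wedge, vec_smul, smul_mul_smul_comm, mul_comm t s]
  module

theorem area_sq (v w : E) : area v w ^ 2 = ‖v‖ ^ 2 * ‖w‖ ^ 2 - inner ℝ v w ^ 2 := by
  rw [area, Real.sq_sqrt]
  have := abs_real_inner_le_norm v w
  have h2 := abs_nonneg (inner ℝ v w : ℝ)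
  nlinarith [sq_abs (inner ℝ v w : ℝ)]

theorem area_smul_smul (s t : ℝ) (v w : E) (hst : 0 ≤ s * t) :
    area (s • v) (t • w) = (s * t) * area v w := by
  rw [area, area, inner_smul_left, inner_smul_right, norm_smul, norm_smul]
  rw [show (‖s‖ * ‖v‖) ^ 2 * (‖t‖ * ‖w‖) ^ 2 -
    ((starRingEnd ℝ) s * (t * inner ℝ v w)) ^ 2 =
      (s * t) ^ 2 * (‖v‖ ^ 2 * ‖w‖ ^ 2 - inner ℝ v w ^ 2) by
    simp only [mul_pow, Real.norm_eq_abs, sq_abs, conj_trivial]; ring]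
  rw [Real.sqrt_mul (sq_nonneg _), Real.sqrt_sq hst]

theorem unitBivector_smul_smul {s t : ℝ} (v w : E) (hst : 0 < s * t) :
    unitBivector (s • v) (t • w) = unitBivector v w := by
  rw [unitBivector, unitBivector, wedge_smul_smul, area_smul_smul _ _ _ _ hst.le, smul_smul,
    mul_inv, mul_comm (s * t)⁻¹, inv_mul_cancel_right₀ hst.ne']

theorem plane_smul_smul {s t : ℝ} (v w : E) (hs : s ≠ 0) (ht : t ≠ 0) :
    plane (s • v) (t • w) = plane v w := by
  rw [plane, plane, Submodule.span_insert, Submodule.span_insert,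
    Submodule.span_singleton_smul_eq hs.isUnit, Submodule.span_singleton_smul_eq ht.isUnit]

theorem wedge_mul_self (v w : E) : wedge v w * wedge v w = -(area v w ^ 2) • (1 : Cl8) := by
  have h1 : vec v * vec w * (vec v * vec w) =
      (2 * inner ℝ v w : ℝ) • (vec v * vec w) - (‖v‖ ^ 2 * ‖w‖ ^ 2) • (1 : Cl8) := by
    rw [mul_assoc, ← mul_assoc (vec w), vec_mul_swap, sub_mul, mul_sub, smul_mul_assoc, one_mul,
      mul_smul_comm, mul_assoc, vec_mul_self w, mul_smul_comm, mul_one, mul_smul_comm,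
      vec_mul_self, smul_smul, real_inner_self_eq_norm_sq, real_inner_self_eq_norm_sq,
      mul_comm (‖w‖ ^ 2)]
  rw [wedge_eq, sub_mul, mul_sub, mul_sub, h1, area_sq]
  simp only [smul_mul_assoc, mul_smul_comm, one_mul, mul_one]
  module

theorem unitBivector_sq {v w : E} (h : area v w ≠ 0) : unitBivector v w ^ 2 = -1 := by
  rw [sq, unitBivector, smul_mul_smul_comm, wedge_mul_self, smul_smul]
  rw [show (area v w)⁻¹ * (area v w)⁻¹ * -area v w ^ 2 = -1 by field_simp]
  module

theorem wedge_mul_left (v w : E) :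
    wedge v w * vec v = vec ((inner ℝ v w : ℝ) • v - (inner ℝ v v : ℝ) • w) := by
  rw [wedge_eq, sub_mul, mul_assoc, vec_mul_swap, mul_sub, ← mul_assoc, vec_mul_self, vec_sub,
    vec_smul, vec_smul]
  simp only [smul_mul_assoc, mul_smul_comm, one_mul, mul_one]
  module

theorem wedge_mul_right (v w : E) :
    wedge v w * vec w = vec ((inner ℝ w w : ℝ) • v - (inner ℝ v w : ℝ) • w) := by
  rw [wedge_eq, sub_mul, mul_assoc, vec_mul_self, vec_sub, vec_smul, vec_smul]
  simp only [smul_mul_assoc, mul_smul_comm, one_mul, mul_one]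

instance instT2SpaceCl8 : T2Space Cl8 := by
  let b := Module.finBasis ℝ Cl8
  have hc : Continuous b.equivFun.toLinearMap := IsModuleTopology.continuous_of_linearMap _
  exact T2Space.of_injective_continuous b.equivFun.injective hc

/-- The embedding of `ℂ` that sends `I` to a square root `B` of `-1`. -/
noncomputable def complexHom (B : Cl8) (hB : B ^ 2 = -1) : ℂ →ₐ[ℝ] Cl8 :=
  Complex.liftAux B ((sq B).symm.trans hB)

theorem complexHom_apply (B : Cl8) (hB : B ^ 2 = -1) (z : ℂ) :
    complexHom B hB z = z.re • (1 : Cl8) + z.im • B := by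
  rw [complexHom, Complex.liftAux_apply, Algebra.algebraMap_eq_smul_one]

theorem exp_complexHom (B : Cl8) (hB : B ^ 2 = -1) (z : ℂ) :
    NormedSpace.exp (complexHom B hB z) = complexHom B hB (Complex.exp z) := by
  have hc : Continuous (complexHom B hB) :=
    LinearMap.continuous_of_finiteDimensional (complexHom B hB).toLinearMap
  have h := (NormedSpace.exp_series_hasSum_exp' (𝕂 := ℝ) z).map (complexHom B hB) hc
  rw [Complex.exp_eq_exp_ℂ, ← h.tsum_eq, NormedSpace.exp_eq_tsum ℝ]
  simp only [Function.comp_def, map_smul, map_pow]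

theorem exp_smul_eq (B : Cl8) (hB : B ^ 2 = -1) (t : ℝ) :
    NormedSpace.exp (t • B) = complexHom B hB (Complex.exp (t * Complex.I)) := by
  rw [← exp_complexHom, complexHom_apply]
  simp

theorem exp_smul_eq_cos_add_sin (B : Cl8) (hB : B ^ 2 = -1) (t : ℝ) :
    NormedSpace.exp (t • B) = Real.cos t • (1 : Cl8) + Real.sin t • B := by
  rw [exp_smul_eq B hB, complexHom_apply, Complex.exp_ofReal_mul_I_re,
    Complex.exp_ofReal_mul_I_im]

theorem vec_mul_vec_eq_exp {v w : E} {t : ℝ} (ha : area v w ≠ 0)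
    (hcos : inner ℝ v w = ‖v‖ * ‖w‖ * Real.cos t) (hsin : area v w = ‖v‖ * ‖w‖ * Real.sin t) :
    vec v * vec w = (‖v‖ * ‖w‖) • NormedSpace.exp (t • unitBivector v w) := by
  rw [exp_smul_eq_cos_add_sin _ (unitBivector_sq ha), smul_add, smul_smul, smul_smul, ← hcos,
    ← hsin, unitBivector, smul_smul, mul_inv_cancel₀ ha, wedge_eq]
  module

theorem vec_reflection_of_norm_eq_one (a x : E) (ha : ‖a‖ = 1) :
    vec ((Submodule.span ℝ {a})ᗮ.reflection x) = -(vec a * vec x * vec a) := by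
  rw [Submodule.reflection_orthogonal_apply, Submodule.reflection_singleton_apply, ha,
    mul_assoc, vec_mul_swap, mul_sub, ← mul_assoc, vec_mul_self, real_inner_self_eq_norm_sq, ha,
    vec_neg, vec_sub, ← Nat.cast_smul_eq_nsmul ℝ, vec_smul, vec_smul]
  simp only [smul_mul_assoc, mul_smul_comm, one_mul, mul_one]
  norm_num
  module

theorem contractLeft_prod_eq_zero {n : ℕ} (d : Module.Dual ℝ E) (v : Fin n → E)
    (h : ∀ i, d (v i) = 0) :
    CliffordAlgebra.contractLeft (Q := (0 : QuadraticForm ℝ E)) d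
      (ExteriorAlgebra.ιMulti ℝ n v) = 0 := by
  induction n with
  | zero =>
    rw [ExteriorAlgebra.ιMulti_zero_apply]
    exact CliffordAlgebra.contractLeft_one (Q := (0 : QuadraticForm ℝ E)) d
  | succ n ih =>
    rw [ExteriorAlgebra.ιMulti_succ_apply]
    refine (CliffordAlgebra.contractLeft_ι_mul (Q := (0 : QuadraticForm ℝ E)) d _ _).trans ?_
    rw [h 0, zero_smul, zero_sub, neg_eq_zero]
    refine (congrArg _ (ih _ fun i => h i.succ)).trans (mul_zero _)

/-- On products of pairwise orthogonal vectors the isomorphism from the Clifford algebra to the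
exterior algebra replaces the Clifford product by the wedge product. -/
theorem equivExterior_prod_of_orthogonal [Invertible (2 : ℝ)] {n : ℕ} (v : Fin n → E)
    (h : Pairwise fun i j => inner ℝ (v i) (v j) = 0) :
    CliffordAlgebra.equivExterior euclideanForm (List.ofFn fun i => vec (v i)).prod =
      ExteriorAlgebra.ιMulti ℝ n v := by
  induction n with
  | zero =>
    simp only [CliffordAlgebra.equivExterior, List.ofFn_zero, List.prod_nil,
      ExteriorAlgebra.ιMulti_zero_apply]
    exact CliffordAlgebra.changeForm_one CliffordAlgebra.changeForm.associated_neg_proof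
  | succ n ih =>
    have ih' := ih (fun i => v i.succ) fun i j hij => h ((Fin.succ_injective n).ne hij)
    rw [List.ofFn_succ, List.prod_cons, ExteriorAlgebra.ιMulti_succ_apply]
    refine (CliffordAlgebra.changeForm_ι_mul CliffordAlgebra.changeForm.associated_neg_proof
      _ _).trans ?_
    have ih'' : CliffordAlgebra.changeForm CliffordAlgebra.changeForm.associated_neg_proof
      (List.ofFn fun i : Fin n => vec (v i.succ)).prod =
        ExteriorAlgebra.ιMulti ℝ n (fun i => v i.succ) := ih'
    rw [ih'', contractLeft_prod_eq_zero, sub_zero]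
    · rfl
    · intro i
      have h0 : inner ℝ (v 0) (v i.succ) = (0 : ℝ) := h (Fin.succ_ne_zero i).symm
      simp [QuadraticMap.associated_apply, LinearMap.BilinMap.toQuadraticMap]
      rw [norm_add_sq_real, h0]
      ring

theorem map_matrix_smul_eq_det_smul {M N : Type*} [AddCommGroup M] [Module ℝ M]
    [AddCommGroup N] [Module ℝ N] {n : ℕ} (f : M [⋀^Fin n]→ₗ[ℝ] N) (u : Fin n → M)
    (A : Matrix (Fin n) (Fin n) ℝ) :
    f (fun i => ∑ j, A i j • u j) = A.det • f u := by
  have key : f.compLinearMap (Fintype.linearCombination ℝ u) =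
      (LinearMap.toSpanSingleton ℝ N (f u)).compAlternatingMap
        (Matrix.detRowAlternating (R := ℝ) (n := Fin n)) := by
    refine (Pi.basisFun ℝ (Fin n)).ext_alternating fun σ hσ => ?_
    let τ : Equiv.Perm (Fin n) := Equiv.ofBijective σ (Finite.injective_iff_bijective.mp hσ)
    have h1 : (fun i => Pi.basisFun ℝ (Fin n) (σ i)) =
      fun i => (1 : Matrix (Fin n) (Fin n) ℝ) (τ i) := by
      funext i; ext j
      simp [Matrix.one_apply, Pi.single_apply, τ, eq_comm]
    have h2 : Matrix.detRowAlternating (fun i => (1 : Matrix (Fin n) (Fin n) ℝ) (τ i)) =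
      ((Equiv.Perm.sign τ : ℤ) : ℝ) := by
      have := Matrix.det_permute τ (1 : Matrix (Fin n) (Fin n) ℝ)
      rw [Matrix.det_one, mul_one] at this
      exact this
    have h3 : (fun i => Fintype.linearCombination ℝ u (Pi.basisFun ℝ (Fin n) (σ i))) =
        u ∘ τ := by
      funext i
      simp [Fintype.linearCombination_apply, Pi.single_apply, τ]
    rw [AlternatingMap.compLinearMap_apply]
    show f (fun i => Fintype.linearCombination ℝ u (Pi.basisFun ℝ (Fin n) (σ i))) = _
    rw [h3, AlternatingMap.map_perm, h1, LinearMap.compAlternatingMap_apply, h2,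
      LinearMap.toSpanSingleton_apply]
    rw [Units.smul_def, ← Int.cast_smul_eq_zsmul ℝ]
  have h : f (fun i => Fintype.linearCombination ℝ u (A i)) = A.det • f u :=
    congrArg (fun g => g A) key
  simpa only [Fintype.linearCombination_apply] using h

/-- Products of two orthogonal families in the same subspace differ by the determinant of the
change of basis. -/
theorem prod_vec_eq_det_smul {n : ℕ} (u v : Fin n → E) (A : Matrix (Fin n) (Fin n) ℝ)
    (hv : ∀ i, v i = ∑ j, A i j • u j)
    (hu : Pairwise fun i j => inner ℝ (u i) (u j) = 0)
    (hvo : Pairwise fun i j => inner ℝ (v i) (v j) = 0) :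
    (List.ofFn fun i => vec (v i)).prod = A.det • (List.ofFn fun i => vec (u i)).prod := by
  let _ : Invertible (2 : ℝ) := invertibleOfNonzero two_ne_zero
  apply (CliffordAlgebra.equivExterior euclideanForm).injective
  rw [map_smul, equivExterior_prod_of_orthogonal v hvo, equivExterior_prod_of_orthogonal u hu,
    ← map_matrix_smul_eq_det_smul]
  congr 1
  funext i
  exact hv i

/-- The simple roots scaled by `√2`. -/
noncomputable def β : Fin 8 → E :=
  ![!₂[0, 0, 0, 0, 0, -1, 1, 0], !₂[0, 0, 0, 0, -1, 1, 0, 0], !₂[0, 0, 0, -1, 1, 0, 0, 0],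
    !₂[0, 0, -1, 1, 0, 0, 0, 0], !₂[0, -1, 1, 0, 0, 0, 0, 0], !₂[-1, 1, 0, 0, 0, 0, 0, 0],
    (1 / 2 : ℝ) • !₂[1, -1, -1, -1, -1, -1, -1, 1], !₂[1, 1, 0, 0, 0, 0, 0, 0]]

theorem α_eq (i : Fin 8) : α i = (1 / √2 : ℝ) • β i := by
  have h8 : √8 = 2 * √2 := by
    rw [show (8 : ℝ) = 2 ^ 2 * 2 by norm_num, Real.sqrt_mul (by norm_num),
      Real.sqrt_sq (by norm_num)]
  fin_cases i <;> simp [α, β, h8, smul_smul]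

theorem inner_eq_sum_eight (x y : E) : inner ℝ x y = x 0 * y 0 + x 1 * y 1 + x 2 * y 2 +
    x 3 * y 3 + x 4 * y 4 + x 5 * y 5 + x 6 * y 6 + x 7 * y 7 := by
  simp [PiLp.inner_apply, Fin.sum_univ_eight, mul_comm]

theorem inner_β (i j : Fin 8) :
    inner ℝ (β i) (β j) = (CartanMatrix.E₈ (toBourbaki i) (toBourbaki j) : ℝ) := by
  rw [inner_eq_sum_eight]
  fin_cases i <;> fin_cases j <;> simp [β, toBourbaki, CartanMatrix.E₈] <;> norm_num

theorem inner_α (i j : Fin 8) : inner ℝ (α i) (α j) = (1 / 2 : ℝ) * inner ℝ (β i) (β j) := by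
  rw [α_eq, α_eq, inner_smul_left, inner_smul_right, ← mul_assoc]
  congr 1
  simp only [one_div, conj_trivial]
  rw [← mul_inv, Real.mul_self_sqrt (by norm_num)]

theorem norm_α (i : Fin 8) : ‖α i‖ = 1 := by
  have h : inner ℝ (α i) (α i) = (1 : ℝ) := by
    rw [inner_α, inner_β]
    fin_cases i <;> simp [toBourbaki, CartanMatrix.E₈]
  rw [real_inner_self_eq_norm_sq] at h
  nlinarith [norm_nonneg (α i)]

theorem cartanMatrix_α (i j : Fin 8) : 2 * inner ℝ (α i) (α j) / inner ℝ (α j) (α j) =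
    (CartanMatrix.E₈ (toBourbaki i) (toBourbaki j) : ℝ) := by
  rw [real_inner_self_eq_norm_sq, norm_α, inner_α, inner_β]; ring

theorem coxeterVersor_eq : coxeterVersor = (1 / 16 : ℝ) •
    (vec (β 1) * vec (β 3) * vec (β 5) * vec (β 7) * vec (β 2) * vec (β 4) * vec (β 0) *
      vec (β 6)) := by
  have h16 : (1 / √2 * (1 / √2) * (1 / √2) * (1 / √2) * (1 / √2) * (1 / √2) * (1 / √2) *
      (1 / √2) : ℝ) = 1 / 16 := by
    have h2 : (1 / √2 * (1 / √2) : ℝ) = 1 / 2 := by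
      rw [one_div_mul_one_div, Real.mul_self_sqrt (by norm_num)]
    linear_combination ((1 / √2 : ℝ) ^ 6 + (1 / √2) ^ 4 / 2 + (1 / √2) ^ 2 / 4 + 1 / 8) * h2
  rw [coxeterVersor]
  simp only [α_eq, vec_smul, smul_mul_smul_comm]
  rw [h16]

theorem vec_coxeterElement (x : E) : vec (coxeterElement x) =
    CliffordAlgebra.reverse coxeterVersor * vec x * coxeterVersor := by
  have hs : ∀ i x, vec (simpleReflection i x) = -(vec (α i) * vec x * vec (α i)) :=
    fun i x => vec_reflection_of_norm_eq_one (α i) x (norm_α i)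
  have hr : ∀ v, CliffordAlgebra.reverse (vec v) = vec v := fun v => CliffordAlgebra.reverse_ι v
  simp only [coxeterElement, LinearIsometryEquiv.coe_mul, Function.comp_apply, hs, coxeterVersor,
    CliffordAlgebra.reverse.map_mul, hr, mul_neg, neg_mul, neg_neg, mul_assoc]

theorem reverse_coxeterVersor_mul_self :
    CliffordAlgebra.reverse coxeterVersor * coxeterVersor = 1 := by
  have h : ∀ i (y : Cl8), vec (α i) * (vec (α i) * y) = y := fun i y => by
    rw [← mul_assoc, vec_mul_self, real_inner_self_eq_norm_sq, norm_α]; simp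
  have h' : ∀ i, vec (α i) * vec (α i) = 1 := fun i => by
    rw [vec_mul_self, real_inner_self_eq_norm_sq, norm_α]; simp
  have hr : ∀ v, CliffordAlgebra.reverse (vec v) = vec v := fun v => CliffordAlgebra.reverse_ι v
  simp only [coxeterVersor, CliffordAlgebra.reverse.map_mul, hr, mul_assoc, h, h']

theorem e_mul_self (k : ℕ) : e k * e k = 1 := by
  rw [e, vec_mul_self]; simp

theorem e_congr {j k : ℕ} (h : (k - 1) % 8 = (j - 1) % 8) : e k = e j := by
  rw [e, e, show Fin.ofNat 8 (k - 1) = Fin.ofNat 8 (j - 1) from Fin.ext h]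

theorem e_mul_e_swap {j k : ℕ} (h : (k - 1) % 8 ≠ (j - 1) % 8) : e k * e j = -(e j * e k) := by
  refine vec_mul_of_inner_eq_zero ?_
  have : Fin.ofNat 8 (j - 1) ≠ Fin.ofNat 8 (k - 1) := fun h' => h (congrArg Fin.val h').symm
  simp [EuclideanSpace.inner_single_left, -Fin.ofNat_eq_cast, this]

theorem blade_cons (k : ℕ) (l : List ℕ) : blade (k :: l) = e k * blade l := by simp [blade]

/-- The signed blade obtained from a blade by multiplication by `e k` on the left. -/
def eMulBlade (k : ℕ) : List ℕ → ℤ × List ℕ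
  | [] => (1, [k])
  | j :: l =>
    if (k - 1) % 8 = (j - 1) % 8 then (1, l)
    else if k < j then (1, k :: j :: l)
    else (-(eMulBlade k l).1, j :: (eMulBlade k l).2)

theorem eMulBlade_spec (k : ℕ) (l : List ℕ) :
    e k * blade l = ((eMulBlade k l).1 : ℝ) • blade (eMulBlade k l).2 := by
  induction l with
  | nil => simp [eMulBlade, blade]
  | cons j l ih =>
    rw [eMulBlade]
    split_ifs with h1 h2
    · rw [blade_cons, e_congr h1, ← mul_assoc, e_mul_self]; simp
    · simp [blade_cons]
    · rw [blade_cons, ← mul_assoc, e_mul_e_swap h1, neg_mul, mul_assoc, ih, blade_cons]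
      simp

/-- The Clifford number with the given blade terms. -/
noncomputable def bladeSum (p : List (ℤ × List ℕ)) : Cl8 :=
  (p.map fun t => (t.1 : ℝ) • blade t.2).sum

theorem bladeSum_cons (t : ℤ × List ℕ) (p : List (ℤ × List ℕ)) :
    bladeSum (t :: p) = (t.1 : ℝ) • blade t.2 + bladeSum p := by simp [bladeSum]

theorem bladeSum_append (p q : List (ℤ × List ℕ)) :
    bladeSum (p ++ q) = bladeSum p + bladeSum q := by simp [bladeSum]

/-- Add a blade term to a list of terms, merging it with a term with the same blade. -/
def addTerm (t : ℤ × List ℕ) : List (ℤ × List ℕ) → List (ℤ × List ℕ)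
  | [] => [t]
  | s :: p => if s.2 = t.2 then (s.1 + t.1, s.2) :: p else s :: addTerm t p

theorem bladeSum_addTerm (t : ℤ × List ℕ) (p : List (ℤ × List ℕ)) :
    bladeSum (addTerm t p) = (t.1 : ℝ) • blade t.2 + bladeSum p := by
  induction p with
  | nil => simp [addTerm, bladeSum]
  | cons s p ih =>
    rw [addTerm]
    split_ifs with h
    · simp only [bladeSum_cons, h, Int.cast_add, add_smul]; abel
    · rw [bladeSum_cons, bladeSum_cons, ih]; abel

/-- Merge the terms with equal blades. -/
def collect (p : List (ℤ × List ℕ)) : List (ℤ × List ℕ) := p.foldr addTerm []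

theorem bladeSum_collect (p : List (ℤ × List ℕ)) : bladeSum (collect p) = bladeSum p := by
  induction p with
  | nil => rfl
  | cons t p ih => rw [bladeSum_cons, ← ih]; exact bladeSum_addTerm t _

/-- The terms of the product of an integral vector and a Clifford number. -/
def vecMulTerms (v : List (ℤ × ℕ)) (p : List (ℤ × List ℕ)) : List (ℤ × List ℕ) :=
  collect (v.flatMap fun s => p.map fun t =>
    (s.1 * t.1 * (eMulBlade s.2 t.2).1, (eMulBlade s.2 t.2).2))

theorem bladeSum_vecMulTerms (v : List (ℤ × ℕ)) (p : List (ℤ × List ℕ)) :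
    bladeSum (vecMulTerms v p) = (v.map fun s => (s.1 : ℝ) • e s.2).sum * bladeSum p := by
  rw [vecMulTerms, bladeSum_collect]
  induction v with
  | nil => simp [bladeSum]
  | cons s v ih =>
    rw [List.flatMap_cons, bladeSum_append, ih, List.map_cons, List.sum_cons, add_mul]
    congr 1
    clear ih
    induction p with
    | nil => simp [bladeSum]
    | cons t p ih =>
      rw [List.map_cons, bladeSum_cons, ih, bladeSum_cons, mul_add, smul_mul_smul_comm,
        eMulBlade_spec, smul_smul]
      push_cast
      rfl

theorem bladeSum_eq_zero {p : List (ℤ × List ℕ)} (h : ∀ t ∈ p, t.1 = 0) : bladeSum p = 0 := by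
  rw [bladeSum]
  refine List.sum_eq_zero fun x hx => ?_
  obtain ⟨t, ht, rfl⟩ := List.mem_map.mp hx
  rw [h t ht]; simp

theorem bladeSum_smul (c : ℤ) (p : List (ℤ × List ℕ)) :
    bladeSum (p.map fun t => (c * t.1, t.2)) = (c : ℝ) • bladeSum p := by
  induction p with
  | nil => simp [bladeSum]
  | cons t p ih => rw [List.map_cons, bladeSum_cons, ih, bladeSum_cons, smul_add, smul_smul]; simp

/-- Twice the scaled simple roots, as integral combinations of the standard basis. -/
def rootTerms : Fin 8 → List (ℤ × ℕ) :=
  ![[(-1, 6), (1, 7)], [(-1, 5), (1, 6)], [(-1, 4), (1, 5)], [(-1, 3), (1, 4)],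
    [(-1, 2), (1, 3)], [(-1, 1), (1, 2)],
    [(1, 1), (-1, 2), (-1, 3), (-1, 4), (-1, 5), (-1, 6), (-1, 7), (1, 8)], [(1, 1), (1, 2)]]

theorem rootTerms_sum (i : Fin 8) :
    ((rootTerms i).map fun s => (s.1 : ℝ) • e s.2).sum =
      (if i = 6 then 2 else 1 : ℝ) • vec (β i) := by
  fin_cases i <;> simp [rootTerms, e, ← vec_smul, ← vec_add] <;> congr 1 <;>
    ext j <;> fin_cases j <;> simp [β] <;> decide

theorem coxeterVersor_expansion : coxeterVersor = (1 / 16 : ℝ) •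
    (versorTerms.map (fun t => (t.1 : ℝ) • blade t.2)).sum := by
  have h0 : bladeSum (collect (vecMulTerms (rootTerms 1) (vecMulTerms (rootTerms 3)
      (vecMulTerms (rootTerms 5) (vecMulTerms (rootTerms 7) (vecMulTerms (rootTerms 2)
      (vecMulTerms (rootTerms 4) (vecMulTerms (rootTerms 0)
      (vecMulTerms (rootTerms 6) [(1, [])]))))))) ++
      versorTerms.map fun t => (-2 * t.1, t.2))) = 0 :=
    bladeSum_eq_zero (by decide +kernel)
  rw [bladeSum_collect, bladeSum_append, bladeSum_smul] at h0
  simp only [bladeSum_vecMulTerms, rootTerms_sum] at h0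
  rw [coxeterVersor_eq]
  have h1 : bladeSum [(1, [])] = 1 := by simp [bladeSum, blade]
  rw [h1] at h0
  simp only [show (1 : Fin 8) ≠ 6 by decide, show (3 : Fin 8) ≠ 6 by decide,
    show (5 : Fin 8) ≠ 6 by decide, show (7 : Fin 8) ≠ 6 by decide,
    show (2 : Fin 8) ≠ 6 by decide, show (4 : Fin 8) ≠ 6 by decide,
    show (0 : Fin 8) ≠ 6 by decide, if_true, if_false, one_smul, mul_one, mul_smul_comm,
    ← mul_assoc] at h0
  have h2 := eq_neg_of_add_eq_zero_left h0
  rw [bladeSum] at h2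
  have h3 := congrArg (fun z => (1 / 2 : ℝ) • z) h2
  simp only [smul_smul, smul_neg] at h3
  norm_num at h3
  rw [h3]

theorem simpleReflection_apply (i : Fin 8) (x : E) :
    simpleReflection i x = x - (inner ℝ (β i) x : ℝ) • β i := by
  rw [simpleReflection, Submodule.reflection_orthogonal_apply,
    Submodule.reflection_singleton_apply, norm_α, α_eq, inner_smul_left,
    ← Nat.cast_smul_eq_nsmul ℝ, smul_smul, smul_smul]
  have h : ((2 : ℕ) : ℝ) * ((starRingEnd ℝ) (1 / √2) * inner ℝ (β i) x / ((1 : ℝ) : ℝ) ^ 2) *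
      (1 / √2) = inner ℝ (β i) x := by
    have h2 : (1 / √2 * (1 / √2) : ℝ) = 1 / 2 := by
      rw [one_div_mul_one_div, Real.mul_self_sqrt (by norm_num)]
    simp only [conj_trivial]
    linear_combination 2 * inner ℝ (β i) x * h2
  simp only [RCLike.ofReal_real_eq_id, id] at *
  rw [h]
  abel

theorem coxeterElement_apply (x : E) : coxeterElement x =
    !₂[-x 0, x 3, -x 1, x 5, x 2, x 6, x 4, x 7] -
      ((-x 0 + x 1 - x 2 - x 3 - x 4 - x 5 - x 6 + x 7) / 4) •
        !₂[1, -1, -1, -1, -1, -1, -1, 1] := by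
  have h1 (a b c d p q r s : ℝ) : simpleReflection 1 !₂[a, b, c, d, p, q, r, s] =
      !₂[a, b, c, d, q, p, r, s] := by
    rw [simpleReflection_apply, inner_eq_sum_eight]
    ext j; fin_cases j <;> simp [β]
  have h3 (a b c d p q r s : ℝ) : simpleReflection 3 !₂[a, b, c, d, p, q, r, s] =
      !₂[a, b, d, c, p, q, r, s] := by
    rw [simpleReflection_apply, inner_eq_sum_eight]
    ext j; fin_cases j <;> simp [β]
  have h5 (a b c d p q r s : ℝ) : simpleReflection 5 !₂[a, b, c, d, p, q, r, s] =
      !₂[b, a, c, d, p, q, r, s] := by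
    rw [simpleReflection_apply, inner_eq_sum_eight]
    ext j; fin_cases j <;> simp [β]
  have h7 (a b c d p q r s : ℝ) : simpleReflection 7 !₂[a, b, c, d, p, q, r, s] =
      !₂[-b, -a, c, d, p, q, r, s] := by
    rw [simpleReflection_apply, inner_eq_sum_eight]
    ext j; fin_cases j <;> simp [β]
  have h2 (a b c d p q r s : ℝ) : simpleReflection 2 !₂[a, b, c, d, p, q, r, s] =
      !₂[a, b, c, p, d, q, r, s] := by
    rw [simpleReflection_apply, inner_eq_sum_eight]
    ext j; fin_cases j <;> simp [β]
  have h4 (a b c d p q r s : ℝ) : simpleReflection 4 !₂[a, b, c, d, p, q, r, s] =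
      !₂[a, c, b, d, p, q, r, s] := by
    rw [simpleReflection_apply, inner_eq_sum_eight]
    ext j; fin_cases j <;> simp [β]
  have h0 (a b c d p q r s : ℝ) : simpleReflection 0 !₂[a, b, c, d, p, q, r, s] =
      !₂[a, b, c, d, p, r, q, s] := by
    rw [simpleReflection_apply, inner_eq_sum_eight]
    ext j; fin_cases j <;> simp [β]
  have h6 (a b c d p q r s : ℝ) : simpleReflection 6 !₂[a, b, c, d, p, q, r, s] =
      !₂[a, b, c, d, p, q, r, s] - ((a - b - c - d - p - q - r + s) / 4) •
        !₂[1, -1, -1, -1, -1, -1, -1, 1] := by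
    rw [simpleReflection_apply, inner_eq_sum_eight]
    ext j; fin_cases j <;> simp [β] <;> ring
  have hx : x = !₂[x 0, x 1, x 2, x 3, x 4, x 5, x 6, x 7] := by
    ext j; fin_cases j <;> rfl
  simp only [coxeterElement, LinearIsometryEquiv.coe_mul, Function.comp_apply]
  conv_lhs => rw [hx, h1, h3, h5, h7, h2, h4, h0, h6]
  congr 2
  ring

/-- The polynomial whose roots are the numbers `4 cos² (π m / 30)`, `m = 1, 7, 11, 13`. -/
def quartic (u : ℝ) : ℝ := u ^ 4 - 7 * u ^ 3 + 14 * u ^ 2 - 8 * u + 1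

/-- The component in the span of `α_1, α_3, α_5, α_7` of an eigenvector of the Dynkin diagram. -/
noncomputable def oddPart (u : ℝ) : E :=
  (u ^ 2 - 4 * u + 2) • β 2 + (u - 1) • β 4 + (u ^ 3 - 6 * u ^ 2 + 9 * u - 3) • β 0 + β 6

/-- The component in the span of `α_2, α_4, α_6, α_8` of an eigenvector of the Dynkin diagram. -/
noncomputable def evenPart (u : ℝ) : E :=
  (u ^ 3 - 5 * u ^ 2 + 5 * u - 1) • β 1 + (u ^ 2 - 3 * u + 1) • β 3 + u • β 5 + (u - 1) • β 7

/-- The sum of the squares of the coefficients of `oddPart u`. -/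
def weight (u : ℝ) : ℝ :=
  (u ^ 2 - 4 * u + 2) ^ 2 + (u - 1) ^ 2 + (u ^ 3 - 6 * u ^ 2 + 9 * u - 3) ^ 2 + 1

theorem weight_pos (u : ℝ) : 0 < weight u := by unfold weight; positivity

/-- The vector of the plane of `u` orthogonal to `α_2, α_4, α_6, α_8`. -/
noncomputable def planeFst (u : ℝ) : E := oddPart u + (1 / 2 : ℝ) • evenPart u

/-- The vector of the plane of `u` orthogonal to `α_1, α_3, α_5, α_7`. -/
noncomputable def planeSnd (u : ℝ) : E := evenPart u + (u / 2) • oddPart u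

theorem inner_oddPart_oddPart (u : ℝ) : inner ℝ (oddPart u) (oddPart u) = 2 * weight u := by
  rw [inner_eq_sum_eight, weight]
  simp [oddPart, β]
  ring

theorem inner_evenPart_evenPart {u : ℝ} (hu : quartic u = 0) :
    inner ℝ (evenPart u) (evenPart u) = 2 * u * weight u := by
  rw [quartic] at hu
  rw [inner_eq_sum_eight, weight]
  simp [evenPart, β]
  linear_combination -2 * (u ^ 3 - 6 * u ^ 2 + 9 * u - 3) * hu

theorem inner_oddPart_evenPart {u : ℝ} (hu : quartic u = 0) :
    inner ℝ (oddPart u) (evenPart u) = -u * weight u := by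
  rw [quartic] at hu
  rw [inner_eq_sum_eight, weight]
  simp [oddPart, evenPart, β]
  linear_combination (u ^ 3 - 6 * u ^ 2 + 9 * u - 3) * hu

theorem coxeterElement_oddPart {u : ℝ} (hu : quartic u = 0) :
    coxeterElement (oddPart u) = evenPart u + (u - 1) • oddPart u := by
  rw [quartic] at hu
  rw [coxeterElement_apply]
  ext j; fin_cases j <;> simp [oddPart, evenPart, β] <;>
    first | ring1 | linear_combination hu | linear_combination -hu

theorem coxeterElement_evenPart {u : ℝ} (hu : quartic u = 0) :
    coxeterElement (evenPart u) = -evenPart u - u • oddPart u := by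
  rw [quartic] at hu
  rw [coxeterElement_apply]
  ext j; fin_cases j <;> simp [oddPart, evenPart, β] <;>
    first | ring1 | linear_combination hu | linear_combination -hu

theorem coxeterElement_planeFst {u : ℝ} (hu : quartic u = 0) :
    coxeterElement (planeFst u) = planeSnd u - planeFst u := by
  rw [planeFst, planeSnd, map_add, map_smul, coxeterElement_oddPart hu,
    coxeterElement_evenPart hu]
  module

theorem coxeterElement_planeSnd {u : ℝ} (hu : quartic u = 0) :
    coxeterElement (planeSnd u) = (u - 1) • planeSnd u - u • planeFst u := by
  rw [planeFst, planeSnd, map_add, map_smul, coxeterElement_oddPart hu,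
    coxeterElement_evenPart hu]
  module

theorem inner_planeFst_planeFst {u : ℝ} (hu : quartic u = 0) :
    inner ℝ (planeFst u) (planeFst u) = 2 * weight u * (1 - u / 4) := by
  simp only [planeFst, inner_add_left, inner_add_right, inner_smul_left, inner_smul_right,
    conj_trivial, inner_oddPart_oddPart, inner_evenPart_evenPart hu, inner_oddPart_evenPart hu,
    real_inner_comm (oddPart u) (evenPart u)]
  ring

theorem inner_planeSnd_planeSnd {u : ℝ} (hu : quartic u = 0) :
    inner ℝ (planeSnd u) (planeSnd u) = 2 * u * weight u * (1 - u / 4) := by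
  simp only [planeSnd, inner_add_left, inner_add_right, inner_smul_left, inner_smul_right,
    conj_trivial, inner_oddPart_oddPart, inner_evenPart_evenPart hu, inner_oddPart_evenPart hu,
    real_inner_comm (oddPart u) (evenPart u)]
  ring

theorem inner_planeFst_planeSnd {u : ℝ} (hu : quartic u = 0) :
    inner ℝ (planeFst u) (planeSnd u) = u * weight u * (1 - u / 4) := by
  simp only [planeFst, planeSnd, inner_add_left, inner_add_right, inner_smul_left,
    inner_smul_right, conj_trivial, inner_oddPart_oddPart, inner_evenPart_evenPart hu,
    inner_oddPart_evenPart hu, real_inner_comm (oddPart u) (evenPart u)]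
  ring

theorem vec_planeFst_mul_vec_planeSnd {u : ℝ} (hu : quartic u = 0) :
    vec (planeFst u) * vec (planeSnd u) =
      -(1 - u / 4) • (vec (evenPart u) * vec (oddPart u)) := by
  have h := vec_mul_swap (evenPart u) (oddPart u)
  rw [real_inner_comm, inner_oddPart_evenPart hu] at h
  simp only [planeFst, planeSnd, vec_add, vec_smul, add_mul, mul_add, smul_mul_assoc,
    mul_smul_comm, vec_mul_self, inner_oddPart_oddPart, inner_evenPart_evenPart hu, h]
  module

theorem coxeterElement_coxeterElement {u : ℝ} (hu : quartic u = 0) {x : E}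
    (hx : x ∈ plane (planeFst u) (planeSnd u)) :
    coxeterElement (coxeterElement x) = (u - 2) • coxeterElement x - x := by
  obtain ⟨s, t, rfl⟩ := Submodule.mem_span_pair.mp hx
  simp only [map_add, map_sub, map_smul, coxeterElement_planeFst hu, coxeterElement_planeSnd hu]
  module

theorem coxeterElement_mem_plane {u : ℝ} (hu : quartic u = 0) {x : E}
    (hx : x ∈ plane (planeFst u) (planeSnd u)) :
    coxeterElement x ∈ plane (planeFst u) (planeSnd u) := by
  obtain ⟨s, t, rfl⟩ := Submodule.mem_span_pair.mp hx
  refine Submodule.mem_span_pair.mpr ⟨-s - t * u, s + t * (u - 1), ?_⟩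
  simp only [map_add, map_smul, coxeterElement_planeFst hu, coxeterElement_planeSnd hu]
  module

theorem inner_eq_zero_of_mem_plane {u u' : ℝ} (hu : quartic u = 0) (hu' : quartic u' = 0)
    (hne : u ≠ u') {x y : E} (hx : x ∈ plane (planeFst u) (planeSnd u))
    (hy : y ∈ plane (planeFst u') (planeSnd u')) : inner ℝ x y = (0 : ℝ) := by
  have h1 : inner ℝ (coxeterElement (coxeterElement x) + x) (coxeterElement y) =
      (u - 2) * inner ℝ x y := by
    rw [coxeterElement_coxeterElement hu hx, sub_add_cancel, inner_smul_left,
      LinearIsometryEquiv.inner_map_map, conj_trivial]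
  have h2 : inner ℝ (coxeterElement x) (coxeterElement (coxeterElement y) + y) =
      (u' - 2) * inner ℝ x y := by
    rw [coxeterElement_coxeterElement hu' hy, sub_add_cancel, inner_smul_right,
      LinearIsometryEquiv.inner_map_map]
  rw [inner_add_left, LinearIsometryEquiv.inner_map_map] at h1
  rw [inner_add_right, LinearIsometryEquiv.inner_map_map] at h2
  have h3 : (u - u') * inner ℝ x y = 0 := by linear_combination h2 - h1
  exact (mul_eq_zero.mp h3).resolve_left (sub_ne_zero.mpr hne)

theorem oddPart_mem_plane {u : ℝ} (hu4 : u < 4) :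
    oddPart u ∈ plane (planeFst u) (planeSnd u) := by
  have h : 4 - u ≠ 0 := by linarith
  refine Submodule.mem_span_pair.mpr ⟨4 / (4 - u), -2 / (4 - u), ?_⟩
  rw [planeFst, planeSnd]
  match_scalars <;> field_simp <;> ring

theorem evenPart_mem_plane {u : ℝ} (hu4 : u < 4) :
    evenPart u ∈ plane (planeFst u) (planeSnd u) := by
  have h : 4 - u ≠ 0 := by linarith
  refine Submodule.mem_span_pair.mpr ⟨-2 * u / (4 - u), 4 / (4 - u), ?_⟩
  rw [planeFst, planeSnd]
  match_scalars <;> field_simp <;> ring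

section Rotation

variable {u θ : ℝ}

theorem norm_planeFst_mul_norm_planeSnd (hu : quartic u = 0) (hθ : u = 4 * Real.cos θ ^ 2)
    (hc : 0 < Real.cos θ) :
    ‖planeFst u‖ * ‖planeSnd u‖ = 4 * weight u * Real.sin θ ^ 2 * Real.cos θ := by
  have hw := weight_pos u
  have h1 := inner_planeFst_planeFst hu
  have h2 := inner_planeSnd_planeSnd hu
  have hS : 1 - u / 4 = Real.sin θ ^ 2 := by rw [hθ, Real.sin_sq]; ring
  rw [real_inner_self_eq_norm_sq, hS] at h1 h2
  rw [← sq_eq_sq₀ (by positivity) (by positivity), mul_pow, h1, h2]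
  linear_combination 4 * weight u ^ 2 * Real.sin θ ^ 4 * hθ

theorem area_planeFst_planeSnd (hu : quartic u = 0) (hθ : u = 4 * Real.cos θ ^ 2)
    (hc : 0 < Real.cos θ) (hs : 0 < Real.sin θ) :
    area (planeFst u) (planeSnd u) = 4 * weight u * Real.sin θ ^ 3 * Real.cos θ := by
  have hw := weight_pos u
  have hS : 1 - u / 4 = Real.sin θ ^ 2 := by rw [hθ, Real.sin_sq]; ring
  have h0 : 0 ≤ area (planeFst u) (planeSnd u) := Real.sqrt_nonneg _
  rw [← sq_eq_sq₀ h0 (by positivity), area_sq, ← mul_pow,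
    norm_planeFst_mul_norm_planeSnd hu hθ hc, inner_planeFst_planeSnd hu, hS]
  linear_combination -16 * weight u ^ 2 * Real.sin θ ^ 4 * Real.cos θ ^ 2 *
    Real.sin_sq_add_cos_sq θ - weight u ^ 2 * Real.sin θ ^ 4 * (u + 4 * Real.cos θ ^ 2) * hθ

theorem area_planeFst_planeSnd_pos (hu : quartic u = 0) (hθ : u = 4 * Real.cos θ ^ 2)
    (hc : 0 < Real.cos θ) (hs : 0 < Real.sin θ) : 0 < area (planeFst u) (planeSnd u) := by
  have hw := weight_pos u
  rw [area_planeFst_planeSnd hu hθ hc hs]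
  positivity

theorem planeFst_mul_planeSnd_eq_exp (hu : quartic u = 0) (hθ : u = 4 * Real.cos θ ^ 2)
    (hc : 0 < Real.cos θ) (hs : 0 < Real.sin θ) :
    vec (planeFst u) * vec (planeSnd u) = (‖planeFst u‖ * ‖planeSnd u‖) •
      NormedSpace.exp (θ • unitBivector (planeFst u) (planeSnd u)) := by
  have hS : 1 - u / 4 = Real.sin θ ^ 2 := by rw [hθ, Real.sin_sq]; ring
  refine vec_mul_vec_eq_exp (area_planeFst_planeSnd_pos hu hθ hc hs).ne' ?_ ?_
  · rw [norm_planeFst_mul_norm_planeSnd hu hθ hc, inner_planeFst_planeSnd hu, hS]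
    linear_combination weight u * Real.sin θ ^ 2 * hθ
  · rw [norm_planeFst_mul_norm_planeSnd hu hθ hc, area_planeFst_planeSnd hu hθ hc hs]
    ring

theorem vec_coxeterElement_eq_exp_mul (hu : quartic u = 0) (hθ : u = 4 * Real.cos θ ^ 2)
    (hc : 0 < Real.cos θ) (hs : 0 < Real.sin θ) {x : E}
    (hx : x ∈ plane (planeFst u) (planeSnd u)) :
    vec (coxeterElement x) =
      NormedSpace.exp (-(2 * θ) • unitBivector (planeFst u) (planeSnd u)) * vec x := by
  have ha := area_planeFst_planeSnd_pos hu hθ hc hs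
  have hw := weight_pos u
  have hS : 1 - u / 4 = Real.sin θ ^ 2 := by rw [hθ, Real.sin_sq]; ring
  have hk : Real.sin (2 * θ) * (area (planeFst u) (planeSnd u))⁻¹ =
      (2 * weight u * (1 - u / 4))⁻¹ := by
    rw [area_planeFst_planeSnd hu hθ hc hs, Real.sin_two_mul, hS]
    field_simp
    norm_num
  have hc2 : Real.cos (2 * θ) = u / 2 - 1 := by rw [Real.cos_two_mul, hθ]; ring
  have h4 : 4 - u ≠ 0 := by
    have : 0 < Real.sin θ ^ 2 := by positivity
    linarith
  have hv : vec (coxeterElement (planeFst u)) =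
      NormedSpace.exp (-(2 * θ) • unitBivector (planeFst u) (planeSnd u)) *
        vec (planeFst u) := by
    rw [exp_smul_eq_cos_add_sin _ (unitBivector_sq ha.ne'), Real.cos_neg, Real.sin_neg,
      add_mul, unitBivector, smul_smul, neg_mul, hk, smul_mul_assoc, smul_mul_assoc, one_mul,
      wedge_mul_left, ← vec_smul, ← vec_smul, ← vec_add, coxeterElement_planeFst hu,
      inner_planeFst_planeFst hu, inner_planeFst_planeSnd hu, hc2]
    congr 1
    match_scalars
    all_goals field_simp
    all_goals ring
  have hw' : vec (coxeterElement (planeSnd u)) =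
      NormedSpace.exp (-(2 * θ) • unitBivector (planeFst u) (planeSnd u)) *
        vec (planeSnd u) := by
    rw [exp_smul_eq_cos_add_sin _ (unitBivector_sq ha.ne'), Real.cos_neg, Real.sin_neg,
      add_mul, unitBivector, smul_smul, neg_mul, hk, smul_mul_assoc, smul_mul_assoc, one_mul,
      wedge_mul_right, ← vec_smul, ← vec_smul, ← vec_add, coxeterElement_planeSnd hu,
      inner_planeSnd_planeSnd hu, inner_planeFst_planeSnd hu, hc2]
    congr 1
    match_scalars
    all_goals field_simp
    all_goals ring
  obtain ⟨s, t, rfl⟩ := Submodule.mem_span_pair.mp hx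
  simp only [map_add, map_smul, vec_add, vec_smul, hv, hw', mul_add, mul_smul_comm]

end Rotation

theorem finrank_plane_eq_two {v w : E} (h : 0 < area v w) :
    Module.finrank ℝ (plane v w) = 2 := by
  have hd : inner ℝ v v * inner ℝ w w - inner ℝ v w ^ 2 ≠ (0 : ℝ) := by
    rw [real_inner_self_eq_norm_sq, real_inner_self_eq_norm_sq, ← area_sq]
    positivity
  have hli : LinearIndependent ℝ ![v, w] := by
    refine LinearIndependent.pair_iff.mpr fun s t hst => ?_
    have h1 := congrArg (fun x => inner ℝ v x) hst
    have h2 := congrArg (fun x => inner ℝ w x) hst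
    simp only [inner_add_right, inner_smul_right, inner_zero_right, real_inner_comm v w]
      at h1 h2
    constructor
    · refine (mul_eq_zero.mp (?_ : s * (inner ℝ v v * inner ℝ w w - inner ℝ v w ^ 2) = 0)
        ).resolve_right hd
      linear_combination inner ℝ w w * h1 - inner ℝ v w * h2
    · refine (mul_eq_zero.mp (?_ : t * (inner ℝ v v * inner ℝ w w - inner ℝ v w ^ 2) = 0)
        ).resolve_right hd
      linear_combination inner ℝ v v * h2 - inner ℝ v w * h1
  have := finrank_span_eq_card hli
  rwa [Matrix.range_cons_cons_empty, Fintype.card_fin] at this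

theorem minimalPeriod_eq_of_rotation (f : E → E) (P : Set E) (hP : ∀ x ∈ P, f x ∈ P)
    (B : Cl8) (hB : B ^ 2 = -1) (n k : ℕ) (hn : n ≠ 0) (hk : k.Coprime n)
    (hf : ∀ x ∈ P, vec (f x) = NormedSpace.exp (-(2 * Real.pi * k / n) • B) * vec x)
    {x : E} (hx : x ∈ P) (hx0 : x ≠ 0) : Function.minimalPeriod f x = n := by
  let z : ℂ := Complex.exp (-(2 * Real.pi * k / n : ℝ) * Complex.I)
  have hz : IsPrimitiveRoot z n := by
    have h := (Complex.isPrimitiveRoot_exp_of_coprime k n hn hk).inv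
    rw [← Complex.exp_neg] at h
    have hz : z = Complex.exp (-(2 * Real.pi * Complex.I * (k / n))) := by
      refine congrArg Complex.exp ?_
      push_cast
      ring
    rwa [hz]
  have hz' : NormedSpace.exp (-(2 * Real.pi * k / n) • B) = complexHom B hB z := by
    rw [exp_smul_eq B hB]
    simp [z]
  have hit : ∀ j : ℕ, f^[j] x ∈ P ∧ vec (f^[j] x) = complexHom B hB (z ^ j) * vec x := by
    intro j
    induction j with
    | zero => simpa using hx
    | succ j ih =>
      rw [Function.iterate_succ_apply']
      refine ⟨hP _ ih.1, ?_⟩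
      rw [hf _ ih.1, ih.2, hz', ← mul_assoc, ← map_mul, pow_succ']
  have hper : ∀ j : ℕ, Function.IsPeriodicPt f j x ↔ n ∣ j := by
    intro j
    rw [← hz.pow_eq_one_iff_dvd]
    constructor
    · intro h
      by_contra hne
      have h1 : complexHom B hB (z ^ j - 1) * vec x = 0 := by
        rw [map_sub, map_one, sub_mul, one_mul, ← (hit j).2, h.eq, sub_self]
      have h2 := congrArg (fun y => complexHom B hB (z ^ j - 1)⁻¹ * y) h1
      simp only [mul_zero] at h2
      rw [← mul_assoc, ← map_mul, inv_mul_cancel₀ (sub_ne_zero.mpr hne), map_one, one_mul] at h2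
      exact vec_ne_zero hx0 h2
    · intro h
      refine vec_injective ?_
      rw [(hit j).2, h, map_one, one_mul]
  exact Nat.dvd_antisymm (Function.IsPeriodicPt.minimalPeriod_dvd ((hper n).mpr dvd_rfl))
    ((hper _).mp (Function.isPeriodicPt_minimalPeriod f x))

/-- Half of the rotation angle of the Coxeter element in the `i`-th plane. -/
noncomputable def halfAngle (i : Fin 4) : ℝ := Real.pi * m i / 30

/-- The root of `quartic` belonging to the `i`-th plane. -/
noncomputable def planeRoot (i : Fin 4) : ℝ := 4 * Real.cos (halfAngle i) ^ 2

theorem halfAngle_mem (i : Fin 4) : 0 < halfAngle i ∧ halfAngle i < Real.pi / 2 := by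
  have hpi := Real.pi_pos
  fin_cases i <;> constructor <;> simp only [halfAngle, m] <;> norm_num <;> nlinarith

theorem cos_halfAngle_pos (i : Fin 4) : 0 < Real.cos (halfAngle i) :=
  Real.cos_pos_of_mem_Ioo ⟨by linarith [halfAngle_mem i, Real.pi_pos], (halfAngle_mem i).2⟩

theorem sin_halfAngle_pos (i : Fin 4) : 0 < Real.sin (halfAngle i) :=
  Real.sin_pos_of_pos_of_lt_pi (halfAngle_mem i).1 (by linarith [halfAngle_mem i, Real.pi_pos])

theorem planeRoot_eq (i : Fin 4) : planeRoot i = 2 + 2 * Real.cos (2 * halfAngle i) := by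
  rw [planeRoot, Real.cos_two_mul]; ring

theorem planeRoot_lt_four (i : Fin 4) : planeRoot i < 4 := by
  have h := sin_halfAngle_pos i
  have h2 := Real.sin_sq_add_cos_sq (halfAngle i)
  rw [planeRoot]
  nlinarith

theorem planeRoot_three : planeRoot 3 = 4 - (planeRoot 0 - 2) ^ 2 := by
  have h : Real.cos (2 * halfAngle 3) = -Real.cos (2 * (2 * halfAngle 0)) := by
    rw [← Real.cos_pi_sub]; congr 1; simp [halfAngle, m]; ring
  rw [planeRoot_eq, h, Real.cos_two_mul, planeRoot_eq]; ring

theorem planeRoot_one : planeRoot 1 = 4 - (planeRoot 3 - 2) ^ 2 := by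
  have h : Real.cos (2 * halfAngle 1) = -Real.cos (2 * (2 * halfAngle 3)) := by
    rw [← Real.cos_sub_pi]; congr 1; simp [halfAngle, m]; ring
  rw [planeRoot_eq, h, Real.cos_two_mul, planeRoot_eq]; ring

theorem planeRoot_two : planeRoot 2 = 4 - (planeRoot 1 - 2) ^ 2 := by
  have h : Real.cos (2 * halfAngle 2) = -Real.cos (2 * (2 * halfAngle 1)) := by
    rw [← Real.cos_sub_pi]; congr 1; simp [halfAngle, m]; ring
  rw [planeRoot_eq, h, Real.cos_two_mul, planeRoot_eq]; ring

theorem planeRoot_zero_gt : 3.9 < planeRoot 0 := by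
  have h := Real.one_sub_sq_div_two_le_cos (x := 2 * halfAngle 0)
  have hpi := Real.pi_lt_d2
  have hpi0 := Real.pi_pos
  have hx : 2 * halfAngle 0 = Real.pi / 15 := by simp [halfAngle, m]; ring
  rw [planeRoot_eq]
  rw [hx] at h ⊢
  nlinarith

theorem quartic_planeRoot_zero : quartic (planeRoot 0) = 0 := by
  have h3 : Real.cos (3 * (2 * halfAngle 0)) = (1 + √5) / 4 := by
    rw [← Real.cos_pi_div_five]; congr 1; simp [halfAngle, m]; ring
  have h5 : √5 ^ 2 = 5 := Real.sq_sqrt (by norm_num)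
  have hu := planeRoot_eq 0
  have hgt := planeRoot_zero_gt
  rw [Real.cos_three_mul] at h3
  set c := Real.cos (2 * halfAngle 0)
  have h : quartic (planeRoot 0) * (4 * c ^ 2 - 2 * c - 1) = 0 := by
    have hs : √5 = 4 * (4 * c ^ 3 - 3 * c) - 1 := by linear_combination -4 * h3
    rw [hs] at h5
    rw [hu, quartic]
    linear_combination h5 / 4
  refine (mul_eq_zero.mp h).resolve_right ?_
  nlinarith

theorem quartic_eq_zero_of_eq {u u' : ℝ} (hu : quartic u = 0) (h : u' = 4 - (u - 2) ^ 2) :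
    quartic u' = 0 := by
  have : quartic u' = quartic u * quartic (4 - u) := by rw [h]; unfold quartic; ring
  rw [this, hu, zero_mul]

theorem quartic_planeRoot (i : Fin 4) : quartic (planeRoot i) = 0 := by
  have h3 := quartic_eq_zero_of_eq quartic_planeRoot_zero planeRoot_three
  have h1 := quartic_eq_zero_of_eq h3 planeRoot_one
  have h2 := quartic_eq_zero_of_eq h1 planeRoot_two
  fin_cases i
  exacts [quartic_planeRoot_zero, h1, h2, h3]

theorem planeRoot_zero_bounds :
    3.95629520146 < planeRoot 0 ∧ planeRoot 0 < 3.95629520147 := by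
  have hq := quartic_planeRoot_zero
  have h1 := planeRoot_zero_gt
  have h2 := planeRoot_lt_four 0
  set u := planeRoot 0
  have mono : ∀ a b : ℝ, 3.9 < a → a ≤ b → quartic a ≤ quartic b := by
    intro a b ha hab
    have h : 0 ≤ (a ^ 2 * (a + b - 7) + b ^ 2 * (a + b - 7) + 14 * (a + b) - 7 * a * b - 8) := by
      obtain ⟨x, rfl⟩ : ∃ x, a = 3.9 + x := ⟨a - 3.9, by ring⟩
      obtain ⟨y, rfl⟩ : ∃ y, b = 3.9 + x + y := ⟨b - 3.9 - x, by ring⟩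
      have hx : 0 < x := by linarith
      have hy : 0 ≤ y := by linarith
      ring_nf
      positivity
    have := mul_nonneg (sub_nonneg.mpr hab) h
    unfold quartic
    nlinarith
  constructor
  · by_contra! h
    have := mono u _ h1 h
    rw [hq] at this
    norm_num [quartic] at this
  · by_contra! h
    have := mono _ u (by norm_num) h
    rw [hq] at this
    norm_num [quartic] at this

theorem planeRoot_three_bounds :
    0.17290908467 < planeRoot 3 ∧ planeRoot 3 < 0.17290908476 := by
  obtain ⟨h1, h2⟩ := planeRoot_zero_bounds
  rw [planeRoot_three]
  constructor <;> nlinarith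

theorem planeRoot_one_bounds :
    0.66173878711 < planeRoot 1 ∧ planeRoot 1 < 0.66173878746 := by
  obtain ⟨h1, h2⟩ := planeRoot_three_bounds
  rw [planeRoot_one]
  constructor <;> nlinarith

theorem planeRoot_two_bounds :
    2.2090569260 < planeRoot 2 ∧ planeRoot 2 < 2.2090569271 := by
  obtain ⟨h1, h2⟩ := planeRoot_one_bounds
  rw [planeRoot_two]
  constructor <;> nlinarith

theorem planeRoot_injective : Function.Injective planeRoot := by
  have h0 := planeRoot_zero_bounds
  have h1 := planeRoot_one_bounds
  have h2 := planeRoot_two_bounds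
  have h3 := planeRoot_three_bounds
  intro i j h
  fin_cases i <;> fin_cases j <;> first | rfl | (exfalso; simp at h; linarith)

/-- The coefficients of the odd parts of the four planes. -/
noncomputable def oddCoeff : Matrix (Fin 4) (Fin 4) ℝ := Matrix.of fun i =>
  ![planeRoot i ^ 2 - 4 * planeRoot i + 2, planeRoot i - 1,
    planeRoot i ^ 3 - 6 * planeRoot i ^ 2 + 9 * planeRoot i - 3, 1]

/-- The coefficients of the even parts of the four planes. -/
noncomputable def evenCoeff : Matrix (Fin 4) (Fin 4) ℝ := Matrix.of fun i =>
  ![planeRoot i ^ 3 - 5 * planeRoot i ^ 2 + 5 * planeRoot i - 1,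
    planeRoot i ^ 2 - 3 * planeRoot i + 1, planeRoot i, planeRoot i - 1]

theorem det_oddCoeff : oddCoeff.det = (Matrix.vandermonde planeRoot).det := by
  have h : oddCoeff = Matrix.vandermonde planeRoot *
      !![2, -1, -3, 1; -4, 1, 9, 0; 1, 0, -6, 0; 0, 0, 1, 0] := by
    ext i j
    fin_cases j <;>
      simp [oddCoeff, Matrix.mul_apply, Fin.sum_univ_four, Matrix.vandermonde_apply] <;> ring
  have hd : (!![2, -1, -3, 1; -4, 1, 9, 0; 1, 0, -6, 0; 0, 0, 1, 0] :
      Matrix (Fin 4) (Fin 4) ℝ).det = 1 := by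
    simp [Matrix.det_succ_row_zero, Fin.sum_univ_succ, Fin.succAbove]
    norm_num
  rw [h, Matrix.det_mul, hd, mul_one]

theorem det_evenCoeff : evenCoeff.det = -(Matrix.vandermonde planeRoot).det := by
  have h : evenCoeff = Matrix.vandermonde planeRoot *
      !![-1, 1, 0, -1; 5, -3, 1, 1; -5, 1, 0, 0; 1, 0, 0, 0] := by
    ext i j
    fin_cases j <;>
      simp [evenCoeff, Matrix.mul_apply, Fin.sum_univ_four, Matrix.vandermonde_apply] <;> ring
  have hd : (!![-1, 1, 0, -1; 5, -3, 1, 1; -5, 1, 0, 0; 1, 0, 0, 0] :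
      Matrix (Fin 4) (Fin 4) ℝ).det = -1 := by
    simp [Matrix.det_succ_row_zero, Fin.sum_univ_succ, Fin.succAbove]
    norm_num
  rw [h, Matrix.det_mul, hd, mul_neg_one]

theorem det_vandermonde_planeRoot_ne_zero : (Matrix.vandermonde planeRoot).det ≠ 0 :=
  Matrix.det_vandermonde_ne_zero_iff.mpr planeRoot_injective

theorem inner_parts_eq_zero {i j : Fin 4} (h : i ≠ j) {x y : E}
    (hx : x = oddPart (planeRoot i) ∨ x = evenPart (planeRoot i))
    (hy : y = oddPart (planeRoot j) ∨ y = evenPart (planeRoot j)) : inner ℝ x y = (0 : ℝ) := by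
  refine inner_eq_zero_of_mem_plane (quartic_planeRoot i) (quartic_planeRoot j)
    (planeRoot_injective.ne h) ?_ ?_
  · rcases hx with rfl | rfl
    exacts [oddPart_mem_plane (planeRoot_lt_four i), evenPart_mem_plane (planeRoot_lt_four i)]
  · rcases hy with rfl | rfl
    exacts [oddPart_mem_plane (planeRoot_lt_four j), evenPart_mem_plane (planeRoot_lt_four j)]

theorem prod_oddPart :
    vec (oddPart (planeRoot 0)) * vec (oddPart (planeRoot 1)) * vec (oddPart (planeRoot 2)) *
      vec (oddPart (planeRoot 3)) = (Matrix.vandermonde planeRoot).det •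
        (vec (β 2) * vec (β 4) * vec (β 0) * vec (β 6)) := by
  have h := prod_vec_eq_det_smul ![β 2, β 4, β 0, β 6] (fun i => oddPart (planeRoot i)) oddCoeff
    (fun i => by simp [oddCoeff, Fin.sum_univ_four, oddPart])
    (fun i j hij => by
      fin_cases i <;> fin_cases j <;>
        first | exact absurd rfl hij | simp [inner_β, CartanMatrix.E₈, toBourbaki])
    (fun i j hij => inner_parts_eq_zero hij (.inl rfl) (.inl rfl))
  rw [det_oddCoeff] at h
  simpa [List.ofFn_succ, mul_assoc] using h

theorem prod_evenPart :
    vec (evenPart (planeRoot 0)) * vec (evenPart (planeRoot 1)) * vec (evenPart (planeRoot 2)) *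
      vec (evenPart (planeRoot 3)) = -(Matrix.vandermonde planeRoot).det •
        (vec (β 1) * vec (β 3) * vec (β 5) * vec (β 7)) := by
  have h := prod_vec_eq_det_smul ![β 1, β 3, β 5, β 7] (fun i => evenPart (planeRoot i)) evenCoeff
    (fun i => by simp [evenCoeff, Fin.sum_univ_four, evenPart])
    (fun i j hij => by
      fin_cases i <;> fin_cases j <;>
        first | exact absurd rfl hij | simp [inner_β, CartanMatrix.E₈, toBourbaki])
    (fun i j hij => inner_parts_eq_zero hij (.inr rfl) (.inr rfl))
  rw [det_evenCoeff] at h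
  simpa [List.ofFn_succ, mul_assoc] using h

theorem prod_evenPart_mul_prod_oddPart :
    vec (evenPart (planeRoot 0)) * vec (evenPart (planeRoot 1)) * vec (evenPart (planeRoot 2)) *
      vec (evenPart (planeRoot 3)) * (vec (oddPart (planeRoot 0)) * vec (oddPart (planeRoot 1)) *
        vec (oddPart (planeRoot 2)) * vec (oddPart (planeRoot 3))) =
    (vec (evenPart (planeRoot 0)) * vec (oddPart (planeRoot 0))) *
      (vec (evenPart (planeRoot 1)) * vec (oddPart (planeRoot 1))) *
      (vec (evenPart (planeRoot 2)) * vec (oddPart (planeRoot 2))) *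
      (vec (evenPart (planeRoot 3)) * vec (oddPart (planeRoot 3))) := by
  have hs (i j : Fin 4) (h : i ≠ j) : vec (evenPart (planeRoot j)) * vec (oddPart (planeRoot i)) =
      -(vec (oddPart (planeRoot i)) * vec (evenPart (planeRoot j))) :=
    vec_mul_of_inner_eq_zero (inner_parts_eq_zero h (.inl rfl) (.inr rfl))
  have hs' (i j : Fin 4) (h : i ≠ j) (z : Cl8) :
      vec (evenPart (planeRoot j)) * (vec (oddPart (planeRoot i)) * z) =
        -(vec (oddPart (planeRoot i)) * (vec (evenPart (planeRoot j)) * z)) := by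
    rw [← mul_assoc, hs i j h, neg_mul, mul_assoc]
  simp only [mul_assoc, hs' 0 1 (by decide), hs' 0 2 (by decide), hs' 0 3 (by decide),
    hs' 1 2 (by decide), hs' 1 3 (by decide), hs' 2 3 (by decide), mul_neg, neg_neg]

theorem coxeterVersor_eq_smul_prod : ∃ k : ℝ, 0 < k ∧ coxeterVersor = -k •
    ((vec (planeFst (planeRoot 0)) * vec (planeSnd (planeRoot 0))) *
      (vec (planeFst (planeRoot 1)) * vec (planeSnd (planeRoot 1))) *
      (vec (planeFst (planeRoot 2)) * vec (planeSnd (planeRoot 2))) *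
      (vec (planeFst (planeRoot 3)) * vec (planeSnd (planeRoot 3)))) := by
  have hS (i : Fin 4) : 0 < 1 - planeRoot i / 4 := by linarith [planeRoot_lt_four i]
  have hD := det_vandermonde_planeRoot_ne_zero
  have h := prod_evenPart_mul_prod_oddPart
  rw [prod_evenPart, prod_oddPart, smul_mul_smul_comm] at h
  set D := (Matrix.vandermonde planeRoot).det
  have hW : vec (β 1) * vec (β 3) * vec (β 5) * vec (β 7) *
      (vec (β 2) * vec (β 4) * vec (β 0) * vec (β 6)) = (16 : ℝ) • coxeterVersor := by
    rw [coxeterVersor_eq, smul_smul]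
    norm_num [mul_assoc]
  rw [hW] at h
  simp only [vec_planeFst_mul_vec_planeSnd (quartic_planeRoot _), smul_mul_smul_comm, smul_smul,
    ← h]
  set P := (1 - planeRoot 0 / 4) * (1 - planeRoot 1 / 4) * (1 - planeRoot 2 / 4) *
    (1 - planeRoot 3 / 4) with hP
  have hP0 : 0 < P := mul_pos (mul_pos (mul_pos (hS 0) (hS 1)) (hS 2)) (hS 3)
  refine ⟨1 / (16 * D ^ 2 * P), by positivity, ?_⟩
  rw [eq_comm]
  convert one_smul ℝ coxeterVersor using 2
  have : -(1 - planeRoot 0 / 4) * -(1 - planeRoot 1 / 4) * -(1 - planeRoot 2 / 4) *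
    -(1 - planeRoot 3 / 4) = P := by rw [hP]; ring
  rw [this]
  field_simp

theorem coxeterVersor_eq_prod_exp : coxeterVersor =
    -(NormedSpace.exp (halfAngle 0 •
        unitBivector (planeFst (planeRoot 0)) (planeSnd (planeRoot 0))) *
      NormedSpace.exp (halfAngle 1 •
        unitBivector (planeFst (planeRoot 1)) (planeSnd (planeRoot 1))) *
      NormedSpace.exp (halfAngle 2 •
        unitBivector (planeFst (planeRoot 2)) (planeSnd (planeRoot 2))) *
      NormedSpace.exp (halfAngle 3 •
        unitBivector (planeFst (planeRoot 3)) (planeSnd (planeRoot 3)))) := by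
  obtain ⟨k, hk, h⟩ := coxeterVersor_eq_smul_prod
  have hr (v : E) : CliffordAlgebra.reverse (vec v) = vec v := CliffordAlgebra.reverse_ι v
  have hvv (v : E) : vec v * vec v = (‖v‖ ^ 2) • (1 : Cl8) := by
    rw [vec_mul_self, real_inner_self_eq_norm_sq]
  have hvv' (v : E) (z : Cl8) : vec v * (vec v * z) = (‖v‖ ^ 2) • z := by
    rw [← mul_assoc, hvv, smul_mul_assoc, one_mul]
  have h1 := reverse_coxeterVersor_mul_self
  have hnorm (i : Fin 4) : 0 < ‖planeFst (planeRoot i)‖ * ‖planeSnd (planeRoot i)‖ := by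
    rw [norm_planeFst_mul_norm_planeSnd (quartic_planeRoot i) rfl (cos_halfAngle_pos i)]
    have := weight_pos (planeRoot i)
    have := cos_halfAngle_pos i
    have := sin_halfAngle_pos i
    positivity
  have hk1 : k * ((‖planeFst (planeRoot 0)‖ * ‖planeSnd (planeRoot 0)‖) *
      (‖planeFst (planeRoot 1)‖ * ‖planeSnd (planeRoot 1)‖) *
      (‖planeFst (planeRoot 2)‖ * ‖planeSnd (planeRoot 2)‖) *
      (‖planeFst (planeRoot 3)‖ * ‖planeSnd (planeRoot 3)‖)) = 1 := by
    rw [h, map_smul] at h1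
    simp only [CliffordAlgebra.reverse.map_mul, hr, smul_mul_assoc, mul_assoc, hvv, hvv',
      mul_smul_comm, smul_smul] at h1
    have h2 := smul_left_injective ℝ (one_ne_zero (α := Cl8))
      (h1.trans (one_smul ℝ (1 : Cl8)).symm)
    have hp := mul_pos hk (mul_pos (mul_pos (mul_pos (hnorm 0) (hnorm 1)) (hnorm 2)) (hnorm 3))
    rw [← sq_eq_sq₀ hp.le zero_le_one]
    linear_combination h2
  simp only [planeFst_mul_planeSnd_eq_exp (quartic_planeRoot _) rfl (cos_halfAngle_pos _)
    (sin_halfAngle_pos _), smul_mul_smul_comm, smul_smul] at h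
  rw [h, neg_mul, hk1, neg_one_smul]

/-- The factors scaling `planeFst` to the tabulated vectors. -/
noncomputable def fstScale : Fin 4 → ℝ := ![43.542, -2.0376, 1.94143, -0.37156]

/-- The factors scaling `planeSnd` to the tabulated vectors. -/
noncomputable def sndScale : Fin 4 → ℝ := ![21.891, -2.5048, 1.3062, -0.89355]

theorem fstScale_mul_sndScale_pos (i : Fin 4) : 0 < fstScale i * sndScale i := by
  fin_cases i <;> norm_num [fstScale, sndScale]

theorem planeFst_eq (u : ℝ) : planeFst u =
    !₂[0, 0, -2 + 5 / 2 * u - 1 / 2 * u ^ 2, -2 + 5 / 2 * u - 1 / 2 * u ^ 2,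
      2 - 13 / 2 * u + 7 / 2 * u ^ 2 - 1 / 2 * u ^ 3,
      2 - 13 / 2 * u + 7 / 2 * u ^ 2 - 1 / 2 * u ^ 3, -7 / 2 + 9 * u - 6 * u ^ 2 + u ^ 3,
      1 / 2] := by
  ext j
  fin_cases j <;> simp [planeFst, oddPart, evenPart, β] <;> ring

theorem planeSnd_eq {u : ℝ} (hu : quartic u = 0) : planeSnd u =
    !₂[-1 + 1 / 4 * u, -1 + 9 / 4 * u - 1 / 2 * u ^ 2, -1 + 9 / 4 * u - 1 / 2 * u ^ 2,
      1 - 17 / 4 * u + 3 * u ^ 2 - 1 / 2 * u ^ 3, 1 - 17 / 4 * u + 3 * u ^ 2 - 1 / 2 * u ^ 3,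
      -1 / 2 + 9 / 4 * u - 5 / 2 * u ^ 2 + 1 / 2 * u ^ 3,
      -1 / 2 + 9 / 4 * u - 5 / 2 * u ^ 2 + 1 / 2 * u ^ 3, 1 / 4 * u] := by
  rw [quartic] at hu
  ext j
  fin_cases j <;> simp [planeSnd, oddPart, evenPart, β] <;>
    first | ring1 | linear_combination (-1 / 2) * hu | linear_combination (1 / 2) * hu

theorem planeRoot_pow_bounds {u a b : ℝ} (ha : 0 < a) (h : a < u ∧ u < b) :
    (a ^ 2 ≤ u ^ 2 ∧ u ^ 2 ≤ b ^ 2) ∧ a ^ 3 ≤ u ^ 3 ∧ u ^ 3 ≤ b ^ 3 := by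
  have hu : 0 < u := ha.trans h.1
  exact ⟨⟨pow_le_pow_left₀ ha.le h.1.le 2, pow_le_pow_left₀ hu.le h.2.le 2⟩,
    pow_le_pow_left₀ ha.le h.1.le 3, pow_le_pow_left₀ hu.le h.2.le 3⟩

set_option maxHeartbeats 1000000 in
theorem planeFst_approx (i : Fin 4) (j : Fin 8) :
    |(fstScale i • planeFst (planeRoot i)) j - vNum i j| ≤ 1 / 10 ^ 4 * |vNum i j| := by
  rw [planeFst_eq]
  generalize hu : planeRoot i = u
  fin_cases i
  · have h := planeRoot_zero_bounds
    rw [show planeRoot 0 = u from hu] at h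
    obtain ⟨⟨h1, h2⟩, h3, h4⟩ := planeRoot_pow_bounds (by norm_num) h
    obtain ⟨h5, h6⟩ := h
    norm_num at h1 h2 h3 h4 h5 h6
    fin_cases j <;> norm_num [fstScale, vNum, abs_le]
    all_goals constructor <;> linarith
  · have h := planeRoot_one_bounds
    rw [show planeRoot 1 = u from hu] at h
    obtain ⟨⟨h1, h2⟩, h3, h4⟩ := planeRoot_pow_bounds (by norm_num) h
    obtain ⟨h5, h6⟩ := h
    norm_num at h1 h2 h3 h4 h5 h6
    fin_cases j <;> norm_num [fstScale, vNum, abs_le]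
    all_goals constructor <;> linarith
  · have h := planeRoot_two_bounds
    rw [show planeRoot 2 = u from hu] at h
    obtain ⟨⟨h1, h2⟩, h3, h4⟩ := planeRoot_pow_bounds (by norm_num) h
    obtain ⟨h5, h6⟩ := h
    norm_num at h1 h2 h3 h4 h5 h6
    fin_cases j <;> norm_num [fstScale, vNum, abs_le]
    all_goals constructor <;> linarith
  · have h := planeRoot_three_bounds
    rw [show planeRoot 3 = u from hu] at h
    obtain ⟨⟨h1, h2⟩, h3, h4⟩ := planeRoot_pow_bounds (by norm_num) h
    obtain ⟨h5, h6⟩ := h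
    norm_num at h1 h2 h3 h4 h5 h6
    fin_cases j <;> norm_num [fstScale, vNum, abs_le]
    all_goals constructor <;> linarith

set_option maxHeartbeats 1000000 in
theorem planeSnd_approx (i : Fin 4) (j : Fin 8) :
    |(sndScale i • planeSnd (planeRoot i)) j - wNum i j| ≤ 1 / 10 ^ 4 * |wNum i j| := by
  rw [planeSnd_eq (quartic_planeRoot i)]
  generalize hu : planeRoot i = u
  fin_cases i
  · have h := planeRoot_zero_bounds
    rw [show planeRoot 0 = u from hu] at h
    obtain ⟨⟨h1, h2⟩, h3, h4⟩ := planeRoot_pow_bounds (by norm_num) h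
    obtain ⟨h5, h6⟩ := h
    norm_num at h1 h2 h3 h4 h5 h6
    fin_cases j <;> norm_num [sndScale, wNum, abs_le]
    all_goals constructor <;> linarith
  · have h := planeRoot_one_bounds
    rw [show planeRoot 1 = u from hu] at h
    obtain ⟨⟨h1, h2⟩, h3, h4⟩ := planeRoot_pow_bounds (by norm_num) h
    obtain ⟨h5, h6⟩ := h
    norm_num at h1 h2 h3 h4 h5 h6
    fin_cases j <;> norm_num [sndScale, wNum, abs_le]
    all_goals constructor <;> linarith
  · have h := planeRoot_two_bounds
    rw [show planeRoot 2 = u from hu] at h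
    obtain ⟨⟨h1, h2⟩, h3, h4⟩ := planeRoot_pow_bounds (by norm_num) h
    obtain ⟨h5, h6⟩ := h
    norm_num at h1 h2 h3 h4 h5 h6
    fin_cases j <;> norm_num [sndScale, wNum, abs_le]
    all_goals constructor <;> linarith
  · have h := planeRoot_three_bounds
    rw [show planeRoot 3 = u from hu] at h
    obtain ⟨⟨h1, h2⟩, h3, h4⟩ := planeRoot_pow_bounds (by norm_num) h
    obtain ⟨h5, h6⟩ := h
    norm_num at h1 h2 h3 h4 h5 h6
    fin_cases j <;> norm_num [sndScale, wNum, abs_le]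
    all_goals constructor <;> linarith

theorem isRoot_charpoly_of_apply_apply {n : Type*} [Fintype n] [DecidableEq n]
    (f : EuclideanSpace ℝ n →ₗ[ℝ] EuclideanSpace ℝ n) {x : EuclideanSpace ℝ n} (hx : x ≠ 0)
    {z : ℂ} (hz : ‖z‖ = 1) (him : z.im ≠ 0) (h : f (f x) = (2 * z.re) • f x - x) :
    (f.charpoly.map (algebraMap ℝ ℂ)).IsRoot z := by
  let b := (EuclideanSpace.basisFun n ℝ).toBasis
  let M := LinearMap.toMatrix b b f
  have hM (y : EuclideanSpace ℝ n) :
      (M.map (algebraMap ℝ ℂ)).mulVec (fun i => (y i : ℂ)) = fun i => (f y i : ℂ) := by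
    have h1 := LinearMap.toMatrix_mulVec_repr b b f y
    funext i
    have h2 := congrFun h1 i
    have h3 : (b.repr (f y)) i = f y i := by simp [b]
    rw [h3] at h2
    rw [← h2]
    simp [Matrix.mulVec, dotProduct, M, b]
  rw [← LinearMap.charpoly_toMatrix f b, ← Matrix.charpoly_map, Polynomial.IsRoot,
    Matrix.eval_charpoly, ← Matrix.exists_mulVec_eq_zero_iff]
  refine ⟨fun i => (f x i : ℂ) - (starRingEnd ℂ z) * (x i : ℂ), ?_, ?_⟩
  · intro h0
    refine hx ?_
    ext i
    have h1 := congrArg Complex.im (congrFun h0 i)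
    simpa [him] using h1
  · have hv : (fun i => (f x i : ℂ) - (starRingEnd ℂ z) * (x i : ℂ)) =
        (fun i => (f x i : ℂ)) - (starRingEnd ℂ z) • fun i => (x i : ℂ) := rfl
    have hn : z * starRingEnd ℂ z = 1 := by
      rw [Complex.mul_conj, Complex.normSq_eq_norm_sq, hz]; norm_num
    have ht : z + starRingEnd ℂ z = 2 * z.re := by rw [Complex.add_conj]; push_cast; ring
    rw [Matrix.sub_mulVec, hv, Matrix.mulVec_sub, Matrix.mulVec_smul, Matrix.mulVec_sub,
      Matrix.mulVec_smul]
    erw [hM, hM]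
    rw [h]
    funext i
    simp [Matrix.scalar_apply]
    linear_combination (f x i : ℂ) * ht - (x i : ℂ) * hn

theorem isRoot_charpoly_of_isometry_apply_apply (g : E ≃ₗᵢ[ℝ] E) {x : E} (hx : x ≠ 0)
    {z : ℂ} (hz : ‖z‖ = 1) (him : z.im ≠ 0) {c : ℝ} (hc : 2 * z.re = c)
    (h : g (g x) = c • g x - x) :
    (((g.toLinearEquiv : E →ₗ[ℝ] E).charpoly).map (algebraMap ℝ ℂ)).IsRoot z :=
  isRoot_charpoly_of_apply_apply _ hx hz him (hc ▸ h)

theorem planeFst_ne_zero (u : ℝ) : planeFst u ≠ 0 := by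
  intro h
  have h7 := congrArg (fun x : E => x 7) h
  rw [planeFst_eq] at h7
  simp at h7

/-- The exponents of `E₈`. -/
def exponents : Multiset ℕ := {1, 7, 11, 13, 17, 19, 23, 29}

theorem isRoot_charpoly_coxeterElement {k : ℕ} (hk : k ∈ exponents) :
    (((coxeterElement.toLinearEquiv : E →ₗ[ℝ] E).charpoly).map (algebraMap ℝ ℂ)).IsRoot
      (Complex.exp (2 * (Real.pi : ℂ) * Complex.I * (k : ℂ) / 30)) := by
  have hz : Complex.exp (2 * (Real.pi : ℂ) * Complex.I * (k : ℂ) / 30) =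
      Complex.exp ((2 * Real.pi * k / 30 : ℝ) * Complex.I) := by
    congr 1; push_cast; ring
  have key : ∃ i : Fin 4, k = m i ∨ k + m i = 30 := by
    simp only [exponents, Multiset.insert_eq_cons, Multiset.mem_cons, Multiset.mem_singleton] at hk
    rcases hk with rfl | rfl | rfl | rfl | rfl | rfl | rfl | rfl
    exacts [⟨0, by decide⟩, ⟨2, by decide⟩, ⟨1, by decide⟩, ⟨3, by decide⟩, ⟨3, by decide⟩,
      ⟨1, by decide⟩, ⟨2, by decide⟩, ⟨0, by decide⟩]
  obtain ⟨i, hi⟩ := key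
  have hs : 0 < Real.sin (2 * halfAngle i) := by
    refine Real.sin_pos_of_pos_of_lt_pi ?_ ?_ <;> linarith [halfAngle_mem i]
  have hcs : Real.cos (2 * Real.pi * k / 30) = Real.cos (2 * halfAngle i) ∧
      Real.sin (2 * Real.pi * k / 30) ≠ 0 := by
    rcases hi with rfl | hi
    · have : 2 * Real.pi * m i / 30 = 2 * halfAngle i := by rw [halfAngle]; ring
      rw [this]
      exact ⟨rfl, hs.ne'⟩
    · have hk' : (k : ℝ) = 30 - m i := by rw [eq_sub_iff_add_eq]; exact_mod_cast hi
      have : 2 * Real.pi * k / 30 = 2 * Real.pi - 2 * halfAngle i := by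
        rw [halfAngle, hk']; ring
      rw [this, Real.cos_two_pi_sub, Real.sin_two_pi_sub]
      exact ⟨rfl, neg_ne_zero.mpr hs.ne'⟩
  rw [hz]
  refine isRoot_charpoly_of_isometry_apply_apply coxeterElement
    (planeFst_ne_zero (planeRoot i)) (Complex.norm_exp_ofReal_mul_I _) ?_ ?_
    (coxeterElement_coxeterElement (quartic_planeRoot i) (Submodule.subset_span (by simp)))
  · rw [Complex.exp_ofReal_mul_I_im]
    exact hcs.2
  · rw [Complex.exp_ofReal_mul_I_re, hcs.1, planeRoot_eq]
    ring

theorem exp_exponents_nodup : (exponents.map (fun k : ℕ =>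
    Complex.exp (2 * (Real.pi : ℂ) * Complex.I * (k : ℂ) / 30))).Nodup := by
  refine Multiset.Nodup.map_on ?_ (by decide)
  have hlt : ∀ k ∈ exponents, k < 30 := by decide
  intro j hj k hk h
  have hp := Complex.isPrimitiveRoot_exp 30 (by norm_num)
  have he (l : ℕ) : Complex.exp (2 * (Real.pi : ℂ) * Complex.I * (l : ℂ) / 30) =
      Complex.exp (2 * Real.pi * Complex.I / (30 : ℕ)) ^ l := by
    rw [← Complex.exp_nat_mul]; congr 1; push_cast; ring
  rw [he, he] at h
  exact hp.pow_inj (hlt j hj) (hlt k hk) h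

theorem roots_charpoly_coxeterElement :
    ((LinearMap.charpoly (coxeterElement.toLinearEquiv : E →ₗ[ℝ] E)).map
        (algebraMap ℝ ℂ)).roots = exponents.map
        (fun k : ℕ => Complex.exp (2 * (Real.pi : ℂ) * Complex.I * (k : ℂ) / 30)) := by
  have hmon := (LinearMap.charpoly_monic (coxeterElement.toLinearEquiv : E →ₗ[ℝ] E)).map
    (algebraMap ℝ ℂ)
  refine (Multiset.eq_of_le_of_card_le ?_ ?_).symm
  · refine (Multiset.le_iff_subset exp_exponents_nodup).mpr fun z hz => ?_
    obtain ⟨k, hk, rfl⟩ := Multiset.mem_map.mp hz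
    exact (Polynomial.mem_roots hmon.ne_zero).mpr (isRoot_charpoly_coxeterElement hk)
  · refine (Polynomial.card_roots' _).trans ?_
    rw [Polynomial.natDegree_map, LinearMap.charpoly_natDegree]
    simp [exponents]

theorem coxeterElement_pow_thirty : coxeterElement ^ 30 = 1 := by
  set f : E →ₗ[ℝ] E := (coxeterElement.toLinearEquiv : E →ₗ[ℝ] E) with hf
  have hmon := (LinearMap.charpoly_monic f).map (algebraMap ℝ ℂ)
  have hdvd : f.charpoly.map (algebraMap ℝ ℂ) ∣
      (Polynomial.X ^ 30 - 1 : Polynomial ℝ).map (algebraMap ℝ ℂ) := by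
    refine (IsAlgClosed.splits _).dvd_of_roots_le_roots hmon.ne_zero ?_
    rw [roots_charpoly_coxeterElement]
    refine (Multiset.le_iff_subset exp_exponents_nodup).mpr fun z hz => ?_
    obtain ⟨k, hk, rfl⟩ := Multiset.mem_map.mp hz
    have hne : (Polynomial.X ^ 30 - 1 : Polynomial ℝ).map (algebraMap ℝ ℂ) ≠ 0 :=
      ((Polynomial.monic_X_pow_sub_C (1 : ℝ) (n := 30) (by norm_num)).map _).ne_zero
    rw [Polynomial.mem_roots hne, Polynomial.IsRoot]
    simp only [Polynomial.map_sub, Polynomial.map_pow, Polynomial.map_X, Polynomial.map_one,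
      Polynomial.eval_sub, Polynomial.eval_pow, Polynomial.eval_X, Polynomial.eval_one]
    rw [← Complex.exp_nat_mul, sub_eq_zero, Complex.exp_eq_one_iff]
    exact ⟨k, by push_cast; ring⟩
  obtain ⟨q, hq⟩ := (Polynomial.map_dvd_map' _).mp hdvd
  have h := congrArg (Polynomial.aeval f) hq
  rw [map_mul, LinearMap.aeval_self_charpoly, zero_mul, map_sub, map_pow, Polynomial.aeval_X,
    map_one, sub_eq_zero] at h
  ext1 x
  have hpow : ∀ n : ℕ, (f ^ n) x = (coxeterElement ^ n) x := by
    intro n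
    induction n with
    | zero => rfl
    | succ n ih => rw [pow_succ', pow_succ', Module.End.mul_apply, ih, LinearIsometryEquiv.coe_mul]; simp [hf]
  rw [← hpow, h]
  rfl

theorem minimalPeriod_coxeterElement (i : Fin 4) {x : E}
    (hx : x ∈ plane (planeFst (planeRoot i)) (planeSnd (planeRoot i))) (hx0 : x ≠ 0) :
    Function.minimalPeriod coxeterElement x = 30 := by
  have hcop : (m i).Coprime 30 := by fin_cases i <;> decide
  have ha := area_planeFst_planeSnd_pos (quartic_planeRoot i) rfl (cos_halfAngle_pos i)
    (sin_halfAngle_pos i)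
  refine minimalPeriod_eq_of_rotation coxeterElement
    (plane (planeFst (planeRoot i)) (planeSnd (planeRoot i)))
    (fun y hy => coxeterElement_mem_plane (quartic_planeRoot i) hy) _
    (unitBivector_sq ha.ne') 30 (m i) (by norm_num) hcop (fun y hy => ?_) hx hx0
  have he : 2 * Real.pi * m i / (30 : ℕ) = 2 * halfAngle i := by
    rw [halfAngle]; push_cast; ring
  rw [he]
  exact vec_coxeterElement_eq_exp_mul (quartic_planeRoot i) rfl (cos_halfAngle_pos i)
    (sin_halfAngle_pos i) hy

theorem orderOf_coxeterElement : orderOf coxeterElement = 30 := by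
  refine Nat.dvd_antisymm (orderOf_dvd_of_pow_eq_one coxeterElement_pow_thirty) ?_
  rw [← minimalPeriod_coxeterElement 0 (x := planeFst (planeRoot 0))
    (Submodule.subset_span (by simp)) (planeFst_ne_zero _)]
  refine Function.IsPeriodicPt.minimalPeriod_dvd ?_
  have h : ∀ n : ℕ, coxeterElement^[n] (planeFst (planeRoot 0)) =
      (coxeterElement ^ n) (planeFst (planeRoot 0)) := by
    intro n
    induction n with
    | zero => rfl
    | succ n ih => rw [Function.iterate_succ_apply', ih, pow_succ', LinearIsometryEquiv.coe_mul,
        Function.comp_apply]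
  rw [Function.IsPeriodicPt, Function.IsFixedPt, h, pow_orderOf_eq_one]
  rfl

end E8Coxeter

open E8Coxeter in
theorem mainTheorem2 :
    -- the `α i` have the Cartan matrix of `E₈`
    (∀ i j : Fin 8, 2 * inner ℝ (α i) (α j) / inner ℝ (α j) (α j) =
      (CartanMatrix.E₈ (toBourbaki i) (toBourbaki j) : ℝ)) ∧
    -- the expansion of `W` in basis blades
    coxeterVersor = (1 / 16 : ℝ) •
      (versorTerms.map (fun t => (t.1 : ℝ) • blade t.2)).sum ∧
    -- the versor `W` induces the Coxeter element by sandwiching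
    (∀ x : E, vec (coxeterElement x) =
      CliffordAlgebra.reverse coxeterVersor * vec x * coxeterVersor) ∧
    -- the Coxeter number is `30`
    orderOf coxeterElement = 30 ∧
    -- the four planes and the factorisation
    (∃ v w : Fin 4 → E,
      (∀ i j, |v i j - vNum i j| ≤ 1 / 10 ^ 4 * |vNum i j|) ∧
      (∀ i j, |w i j - wNum i j| ≤ 1 / 10 ^ 4 * |wNum i j|) ∧
      (∀ i, Module.finrank ℝ (plane (v i) (w i)) = 2) ∧
      (∀ i j, i ≠ j → plane (v i) (w i) ⟂ plane (v j) (w j)) ∧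
      (∀ i, unitBivector (v i) (w i) ^ 2 = -1) ∧
      coxeterVersor =
        -(NormedSpace.exp ((Real.pi / 30) • unitBivector (v 0) (w 0)) *
          NormedSpace.exp ((11 * Real.pi / 30) • unitBivector (v 1) (w 1)) *
          NormedSpace.exp ((7 * Real.pi / 30) • unitBivector (v 2) (w 2)) *
          NormedSpace.exp ((13 * Real.pi / 30) • unitBivector (v 3) (w 3))) ∧
      -- in the `i`-th plane the Coxeter element is the 30-fold rotation by `2 π m_i / 30`
      (∀ i, ∀ x ∈ plane (v i) (w i),
        coxeterElement x ∈ plane (v i) (w i) ∧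
        vec (coxeterElement x) =
          NormedSpace.exp (-(2 * Real.pi * m i / 30) • unitBivector (v i) (w i)) * vec x ∧
        (x ≠ 0 → Function.minimalPeriod coxeterElement x = 30))) ∧
    -- the exponents: the complex eigenvalues, with multiplicity, are `exp (2 π i k / 30)`
    ((LinearMap.charpoly (coxeterElement.toLinearEquiv : E →ₗ[ℝ] E)).map
        (algebraMap ℝ ℂ)).roots =
      ({1, 7, 11, 13, 17, 19, 23, 29} : Multiset ℕ).map
        (fun k : ℕ => Complex.exp (2 * (Real.pi : ℂ) * Complex.I * (k : ℂ) / 30)) := by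
  have hpos := fstScale_mul_sndScale_pos
  have hplane (i : Fin 4) : plane (fstScale i • planeFst (planeRoot i))
      (sndScale i • planeSnd (planeRoot i)) =
        plane (planeFst (planeRoot i)) (planeSnd (planeRoot i)) :=
    plane_smul_smul _ _ (left_ne_zero_of_mul (hpos i).ne') (right_ne_zero_of_mul (hpos i).ne')
  have hbiv (i : Fin 4) : unitBivector (fstScale i • planeFst (planeRoot i))
      (sndScale i • planeSnd (planeRoot i)) =
        unitBivector (planeFst (planeRoot i)) (planeSnd (planeRoot i)) :=
    unitBivector_smul_smul _ _ (hpos i)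
  have harea (i : Fin 4) := area_planeFst_planeSnd_pos (quartic_planeRoot i) rfl
    (cos_halfAngle_pos i) (sin_halfAngle_pos i)
  refine ⟨cartanMatrix_α, coxeterVersor_expansion, vec_coxeterElement, orderOf_coxeterElement,
    ⟨fun i => fstScale i • planeFst (planeRoot i), fun i => sndScale i • planeSnd (planeRoot i),
      planeFst_approx, planeSnd_approx, fun i => ?_, fun i j hij => ?_, fun i => ?_, ?_,
      fun i x hx => ?_⟩, roots_charpoly_coxeterElement⟩
  · rw [hplane]
    exact finrank_plane_eq_two (harea i)
  · rw [hplane, hplane]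
    exact Submodule.isOrtho_iff_inner_eq.mpr fun x hx y hy =>
      inner_eq_zero_of_mem_plane (quartic_planeRoot i) (quartic_planeRoot j)
        (planeRoot_injective.ne hij) hx hy
  · rw [hbiv]
    exact unitBivector_sq (harea i).ne'
  · simp only [hbiv]
    have h0 : Real.pi / 30 = halfAngle 0 := by simp [halfAngle, m]
    have h1 : 11 * Real.pi / 30 = halfAngle 1 := by simp [halfAngle, m]; ring
    have h2 : 7 * Real.pi / 30 = halfAngle 2 := by simp [halfAngle, m]; ring
    have h3 : 13 * Real.pi / 30 = halfAngle 3 := by simp [halfAngle, m]; ring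
    rw [h0, h1, h2, h3]
    exact coxeterVersor_eq_prod_exp
  · simp only [hplane, hbiv] at hx ⊢
    refine ⟨coxeterElement_mem_plane (quartic_planeRoot i) hx, ?_,
      minimalPeriod_coxeterElement i hx⟩
    have he : 2 * Real.pi * m i / 30 = 2 * halfAngle i := by rw [halfAngle]; ring
    rw [he]
    exact vec_coxeterElement_eq_exp_mul (quartic_planeRoot i) rfl (cos_halfAngle_pos i)
      (sin_halfAngle_pos i) hx
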